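/- Let $E$ be a finite set of points in an $n$-dimensional real affine space $V$, $n\ge 2$. Let $\Sigma$ be the set of $n$-dimensional simplices with vertices in $E$, and let $\Gamma$ be the set of chambers, i.e. the closures of the connected components of $\mathrm{conv}(E)\setminus\bigcup_{\sigma\in\Sigma}\partial\sigma$. Let $K$ be a field of characteristic $0$, let $A=(a_{\sigma,\gamma})_{\sigma\in\Sigma,\gamma\in\Gamma}$ be the incidence matrix over $K$ ($a_{\sigma,\gamma}=1$ if $\gamma\subset\sigma$, and $0$ otherwise), and let $V_\Sigma$ and $V_\Gamma$ be the spaces spanned by the rows and by the columns of $A$. We call a chamber adjacent to a simplex $F$ of any dimension (a point, an edge, $\ldots$) if it meets the relative interior of $F$. Sets $B\subset\Sigma$ and $B'\subset\Gamma$ are constructed by induction on $n$ as follows; along with each $\sigma\in B$ the construction records the chamber of $B'$ chosen in $\sigma$ and an ordered list of $n-1$ vertices of $\sigma$, its apexes. Order the points as $e_1,\dots,e_N$ so that $\mathrm{conv}(e_1,\dots,e_k)\cap\mathrm{conv}(e_{k+1},\dots,e_N)=\emptyset$ for all $k$. Case $n=2$. For each $k$ consider the edges from $e_k$ to the points $e_i$,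 $i>k$. For every two neighbouring edges (on different rays, with no other such edge between them) let $e_i,e_j$ be the points of $E\setminus\{e_k\}$ on them nearest to $e_k$. Put the triangle $\sigma=\sigma(e_k,e_i,e_j)$ into $B$, with the single apex $e_k$, and put into $B'$ a chamber $\gamma\subset\sigma$ adjacent to $e_k$. Case $n\ge 3$. For each $k$ choose a hyperplane $H_k$ that strictly separates $e_1,\dots,e_k$ from $e_{k+1},\dots,e_N$, and let $E_k$ be the set of points in which the segments $(e_k,e_i)$, $i>k$, meet $H_k$. Carry out the construction for $E_k$ in the $(n-1)$-dimensional space $H_k$, with a suitable ordering of $E_k$, and let $\tilde B_k,\tilde B_k'$ be the result. For $x\in E_k$ let $\bar x$ be the point of $E\setminus\{e_k\}$ on the ray from $e_k$ through $x$ nearest to $e_k$. For each $\sigma^k=\sigma(x_1,\dots,x_n)\in\tilde B_k$, with apexes $y_1,\dots,y_{n-2}$ and chosen chamber $\gamma^k\in\tilde B'_k$, put the simplex $\sigma=\sigma(e_k,\bar x_1,\dots,\bar x_n)$ into $B$, with apexes $e_k,\bar y_1,\dots,\bar y_{n-2}$, and put into $B'$ a chamber $\gamma\in\Gamma$ with $\gamma\subset\sigma$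 which is adjacent to the point $e_k$, to the edge $(e_k,\bar y_1)$, and generally to each of the simplices $\sigma(e_k,\bar y_1,\dots,\bar y_m)$, $0\le m\le n-2$. Then, for every way of making the choices in this construction, $B\subset\Sigma$, $B'\subset\Gamma$, and the chambers in $B'$ (i.e. the corresponding columns of $A$) form a basis of $V_\Gamma$. The simplices in $B$ (i.e. the corresponding rows of $A$) form a basis of $V_\Sigma$. There is a perfect pairing of $V_\Sigma$ and $V_\Gamma$ under which the row of $\sigma$ and the column of $\gamma$ pair to $a_{\sigma,\gamma}$, for all $\sigma\in\Sigma$, $\gamma\in\Gamma$, and with respect to it the two bases form a triangular pair: they can be numbered $B=\{\sigma_1,\dots,\sigma_m\}$, $B'=\{\gamma_1,\dots,\gamma_m\}$ such that $a_{\sigma_i,\gamma_k}=0$ for $i>k$ and $a_{\sigma_i,\gamma_i}=1$ for all $i$. -/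

import Mathlib

open Set

/-! Finite point sets `E` in a real affine space of dimension `n`, modelled on a real normed space
`V`. The recursive construction passes to hyperplanes, hyperplanes in these, and so on. All points
stay in `V`, and the number `n` is always the dimension of the affine subspace in which the
construction is currently running, so the notions below are relative to that subspace. -/

section Geometry

variable {V : Type*} [NormedAddCommGroup V] [NormedSpace ℝ V]

/-- The `n`-dimensional simplices with vertices in `E`, each given by its vertex set. -/
def simplices (n : ℕ) (E : Set V) : Set (Set V) :=
  {s | s ⊆ E ∧ s.ncard = n + 1 ∧ AffineIndependent ℝ ((↑) : s → V)}

/-- The union of the boundaries of all `n`-dimensional simplices with vertices in `E`. The boundary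
is relative to the affine span of the simplex, which is the whole space if that has
dimension `n`. -/
def walls (n : ℕ) (E : Set V) : Set V :=
  ⋃ s ∈ simplices n E, intrinsicFrontier ℝ (convexHull ℝ s)

/-- The chambers: the closures of the connected components of `conv E` minus the walls. -/
def chambers (n : ℕ) (E : Set V) : Set (Set V) :=
  {c | ∃ x ∈ convexHull ℝ E \ walls n E,
    c = closure (connectedComponentIn (convexHull ℝ E \ walls n E) x)}

/-- The ordering condition: for each `k`, the convex hull of the points up to `e k` and the convex
hull of the points after `e k` are disjoint. In particular the points are distinct. -/
def IsSeparatedOrder {N : ℕ} (e : Fin N → V) : Prop :=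
  ∀ k, Disjoint (convexHull ℝ (e '' Iic k)) (convexHull ℝ (e '' Ioi k))

/-- The hyperplane `f = 0` strictly separates the points up to `e k` from those after `e k`. -/
def Separates {N : ℕ} (e : Fin N → V) (k : Fin N) (f : V →ᵃ[ℝ] ℝ) : Prop :=
  (∀ i, i ≤ k → f (e i) < 0) ∧ ∀ i, k < i → 0 < f (e i)

/-- The points in which the segments from `e k` to the later points meet the
hyperplane `f = 0`. -/
def sectionPoints {N : ℕ} (e : Fin N → V) (k : Fin N) (f : V →ᵃ[ℝ] ℝ) : Set V :=
  {x | f x = 0 ∧ ∃ i, k < i ∧ x ∈ openSegment ℝ (e k) (e i)}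

/-- The ray from `a` through `x`, without its origin `a`. -/
def openRay (a x : V) : Set V := AffineMap.lineMap (k := ℝ) a x '' Ioi 0

/-- `y` is the point of `E`, other than `a`, that is nearest to `a` on the ray from `a`
through `x`. -/
def IsNearestOnRay (E : Set V) (a x y : V) : Prop :=
  y ∈ E ∧ y ∈ openRay a x ∧ ∀ z ∈ E, z ∈ openRay a x → y ∈ segment ℝ a z

/-- The point of `E` nearest to `a` on the ray from `a` through `x`. -/
noncomputable def nearest (E : Set V) (a x : V) : V :=
  Classical.epsilon (IsNearestOnRay E a x)

/-- The open angle with vertex `a` between the rays through `x` and through `y`. -/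
def openAngle (a x y : V) : Set V :=
  {z | ∃ s t : ℝ, 0 < s ∧ 0 < t ∧ z = a + s • (x - a) + t • (y - a)}

/-- In the plane, the triangles chosen at `e k`: the triangles spanned by `e k` and two later points
`e i`, `e j` on neighbouring edges from `e k` (two different rays, with no further edge from `e k`
to a later point between them), each being the point nearest to `e k` on its edge. -/
def planeSimplices {N : ℕ} (e : Fin N → V) (k : Fin N) : Set (Set V) :=
  {s | ∃ i j, k < i ∧ k < j ∧ e j ∉ openRay (e k) (e i) ∧
    (∀ l, k < l → e l ∉ openAngle (e k) (e i) (e j)) ∧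
    IsNearestOnRay (range e) (e k) (e i) (e i) ∧
    IsNearestOnRay (range e) (e k) (e j) (e j) ∧
    s = {e k, e i, e j}}

/-- A closed set `c` (a chamber) is adjacent to the simplex spanned by `F` (a point, an edge, ...)
if it meets the relative interior of that simplex. -/
def AdjacentTo (c F : Set V) : Prop :=
  (c ∩ intrinsicInterior ℝ (convexHull ℝ F)).Nonempty

/-- What the algorithm produces at one place: a simplex (by its vertex set), the chamber chosen in
it, and the list `v₀, v₁, …` of those vertices of the simplex at which it was chosen: `v₀` is
the point of `E` at which the simplex was chosen, `v₁` is the vertex that corresponds to the point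
of the hyperplane at which the lower-dimensional simplex was chosen, and so on down to
a plane. -/
@[ext] structure Piece (V : Type*) where
  apexes : List V
  simplex : Set V
  chamber : Set V

/-- The requirement on the chosen chamber: it is a chamber, it lies in the simplex, and it is
adjacent to the point `v₀`, to the edge `v₀ v₁`, to the triangle `v₀ v₁ v₂`, and so on for all
nonempty initial parts of the list of apexes. (The list is `v₀` in dimension 2 and `v₀, v₁` in
dimension 3.) -/
def Piece.Admissible (n : ℕ) (E : Set V) (t : Piece V) : Prop :=
  t.chamber ∈ chambers n E ∧ t.chamber ⊆ convexHull ℝ t.simplex ∧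
    ∀ l : List V, l ≠ [] → l <+: t.apexes → AdjacentTo t.chamber {x | x ∈ l}

/-- Lifting from the hyperplane to a simplex with the additional vertex `a`: each vertex `x` is
replaced by the point of `E` nearest to `a` on the ray from `a` through `x`, and `a` is added. The
chamber `c` of the lifted piece is to be chosen anew. -/
noncomputable def Piece.lift (E : Set V) (a : V) (t : Piece V) (c : Set V) : Piece V where
  apexes := a :: t.apexes.map (nearest E a)
  simplex := insert a (nearest E a '' t.simplex)
  chamber := c

/-- `IsConstruction n e T`: the algorithm in dimension `n ≥ 2`, applied to the ordered points `e`,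
can produce `T`. All choices (orderings, hyperplanes, chambers) are arbitrary. -/
inductive IsConstruction : (n : ℕ) → {N : ℕ} → (Fin N → V) → Set (Piece V) → Prop
  /-- Dimension 2: at each point `e k` take the triangles of `planeSimplices e k`, and choose in each
  of them a chamber adjacent to `e k`. -/
  | plane {N : ℕ} (e : Fin N → V) (he : IsSeparatedOrder e)
      (c : Fin N → Set V → Set V)
      (hc : ∀ k, ∀ s ∈ planeSimplices e k, (Piece.mk [e k] s (c k s)).Admissible 2 (range e)) :
      IsConstruction 2 e {t | ∃ k, ∃ s ∈ planeSimplices e k, t = ⟨[e k], s, c k s⟩}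
  /-- From dimension `n` to dimension `n + 1`: for each `k` take a separating hyperplane `f k = 0`,
  order the section points in it as `e' k`, apply the algorithm to them with result `T k`, lift each
  simplex in `T k`, and choose an admissible chamber in the lifted simplex. -/
  | step {n N : ℕ} (e : Fin N → V) (he : IsSeparatedOrder e)
      (f : Fin N → V →ᵃ[ℝ] ℝ) (hf : ∀ k, Separates e k (f k))
      (M : Fin N → ℕ) (e' : (k : Fin N) → Fin (M k) → V)
      (he' : ∀ k, range (e' k) = sectionPoints e k (f k))
      (T : Fin N → Set (Piece V)) (hT : ∀ k, IsConstruction n (e' k) (T k))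
      (c : Fin N → Piece V → Set V)
      (hc : ∀ k, ∀ t ∈ T k,
        (t.lift (range e) (e k) (c k t)).Admissible (n + 1) (range e)) :
      IsConstruction (n + 1) e
        {t | ∃ k, ∃ t' ∈ T k, t = t'.lift (range e) (e k) (c k t')}

open Classical in
/-- The incidence matrix of simplices and chambers. -/
noncomputable def incidence (K : Type*) [Field K] (n : ℕ) (E : Set V) :
    Matrix (simplices n E) (chambers n E) K :=
  fun s c => if (c : Set V) ⊆ convexHull ℝ (s : Set V) then 1 else 0

/-- The constructed set of simplices. -/
def simplexSet (n : ℕ) (E : Set V) (T : Set (Piece V)) : Set (simplices n E) :=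
  {s | ∃ t ∈ T, t.simplex = s}

/-- The constructed set of chambers. -/
def chamberSet (n : ℕ) (E : Set V) (T : Set (Piece V)) : Set (chambers n E) :=
  {c | ∃ t ∈ T, t.chamber = c}

end Geometry

section LinearAlgebra

variable {K R C : Type*} [Field K]

/-- The space generated by the rows of a matrix. -/
def rowSpace (A : Matrix R C K) : Submodule K (C → K) :=
  Submodule.span K (range fun r c => A r c)

/-- The space generated by the columns of a matrix. -/
def colSpace (A : Matrix R C K) : Submodule K (R → K) :=
  Submodule.span K (range fun c r => A r c)

/-- A row, as an element of the row space. -/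
def rowVec (A : Matrix R C K) (r : R) : rowSpace A :=
  ⟨fun c => A r c, Submodule.subset_span ⟨r, rfl⟩⟩

/-- A column, as an element of the column space. -/
def colVec (A : Matrix R C K) (c : C) : colSpace A :=
  ⟨fun r => A r c, Submodule.subset_span ⟨c, rfl⟩⟩

/-- Two bases of spaces that are dual to each other under the perfect pairing `p` form a triangular
pair. -/
def IsTriangularPair {X Y : Type*} [AddCommGroup X] [Module K X] [AddCommGroup Y] [Module K Y]
    (p : X →ₗ[K] Y →ₗ[K] K) {m : ℕ} (b : Module.Basis (Fin m) K X)
    (c : Module.Basis (Fin m) K Y) : Prop :=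
  p.IsPerfPair ∧ (∀ i k, k < i → p (b i) (c k) = 0) ∧ ∀ i, p (b i) (c i) = 1

end LinearAlgebra

/-! ### Linear algebra of unitriangular minors -/

section TriangularMatrices

variable {K R C : Type*} [Field K]

/-! Everything reduces to two facts about the constructed pieces (`IsTriangularSelection`): suitably
listed, they give a unitriangular minor of the incidence matrix, and their rows span all rows. The
minor is then invertible, so the selected rows and columns are independent, every column is a
combination of the selected columns, and the pairing given by the matrix is perfect.

Spanning is homological. Choose in each chamber a point off the walls, and send an ordered simplex
to its orientation sign times its incidence row (`0` if degenerate). The alternating sum of this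
function over the facets of any `n + 2` points of `E` vanishes: a general point is covered by one
positive and one negative facet, or by none (`AffineBasis.sum_sign_mul_eq_zero`). So it is a
cocycle, and `IsConstruction.cocycle_mem` shows that a cocycle lying in a subgroup `S` on the
constructed simplices lies in `S` everywhere. For this, run through the points from the last to the
first. Coning from `e k` reduces to simplices with vertex `e k`; modulo simplices of later points,
their other vertices slide along rays to the nearest points. What remains is a cocycle on the
section points in one dimension less. In the plane one subdivides angles instead.

Triangularity uses the chosen flags of apexes. If the chamber of `t` lies in the simplex of `s`,
then `s` overlaps `t` in the sense of `Piece.Overlaps`: the open simplices meet, and the simplex of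
`s` meets every open face spanned by initial apexes of `t`. In particular it contains the first apex
`e k` of `t`, which is impossible if `s` was chosen at a later point. If both were chosen at `e k`,
central projection from `e k` preserves overlapping and lowers the dimension, until two triangles
with a common apex in a plane must coincide. Listing the pieces by `k`, and recursively within each
`k`, gives `IsConstruction.exists_pairwise_not_overlaps`. -/

/-- Rows and columns of a matrix, selected so that the selected minor is unitriangular and the
selected rows generate the row space. -/
structure IsTriangularSelection (A : Matrix R C K) {m : ℕ} (σ : Fin m → R) (γ : Fin m → C) :
    Prop where
  upper : ∀ i k, k < i → A (σ i) (γ k) = 0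
  diag : ∀ i, A (σ i) (γ i) = 1
  span : ∀ r, (fun c => A r c) ∈ Submodule.span K (range fun i c => A (σ i) c)

namespace IsTriangularSelection

variable {A : Matrix R C K} {m : ℕ} {σ : Fin m → R} {γ : Fin m → C}

theorem isUnit_minor (h : IsTriangularSelection A σ γ) : IsUnit (A.submatrix σ γ) := by
  rw [Matrix.isUnit_iff_isUnit_det, Matrix.det_of_isUpperTriangular]
  · simp [h.diag]
  · intro i k hik
    exact h.upper i k hik

theorem injective_left (h : IsTriangularSelection A σ γ) : Function.Injective σ := by
  intro i j hij
  by_contra hne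
  rcases lt_or_gt_of_ne hne with hlt | hlt
  · have h1 := h.upper j i hlt
    rw [← hij, h.diag] at h1
    exact one_ne_zero h1
  · have h1 := h.upper i j hlt
    rw [hij, h.diag] at h1
    exact one_ne_zero h1

theorem injective_right (h : IsTriangularSelection A σ γ) : Function.Injective γ := by
  intro i j hij
  by_contra hne
  rcases lt_or_gt_of_ne hne with hlt | hlt
  · have h1 := h.upper j i hlt
    rw [hij, h.diag] at h1
    exact one_ne_zero h1
  · have h1 := h.upper i j hlt
    rw [← hij, h.diag] at h1
    exact one_ne_zero h1

theorem linearIndependent_rowVec (h : IsTriangularSelection A σ γ) :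
    LinearIndependent K fun i => rowVec A (σ i) := by
  rw [Fintype.linearIndependent_iff]
  intro g hg
  have h1 : Matrix.vecMul g (A.submatrix σ γ) = 0 := by
    funext k
    have := congrArg (fun x : rowSpace A => (x : C → K) (γ k)) hg
    simpa [rowVec, Matrix.vecMul, dotProduct, Finset.sum_apply] using this
  have h2 := Matrix.vecMul_injective_of_isUnit h.isUnit_minor (h1.trans (Matrix.zero_vecMul _).symm)
  intro i
  exact congrFun h2 i

theorem linearIndependent_colVec (h : IsTriangularSelection A σ γ) :
    LinearIndependent K fun i => colVec A (γ i) := by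
  rw [Fintype.linearIndependent_iff]
  intro g hg
  have h1 : Matrix.mulVec (A.submatrix σ γ) g = 0 := by
    funext k
    have := congrArg (fun x : colSpace A => (x : R → K) (σ k)) hg
    simpa [colVec, Matrix.mulVec, dotProduct, Finset.sum_apply, mul_comm] using this
  have h2 := Matrix.mulVec_injective_of_isUnit h.isUnit_minor (h1.trans (Matrix.mulVec_zero _).symm)
  intro i
  exact congrFun h2 i

/-- Every column is a combination of the selected ones. -/
theorem exists_col_eq (h : IsTriangularSelection A σ γ) (c : C) :
    ∃ y : Fin m → K, ∀ r, A r c = ∑ k, y k * A r (γ k) := by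
  -- The coefficients are fixed by the selected rows alone; the same `y` then serves all rows, since
  -- these are combinations of the selected ones.
  obtain ⟨y, hy⟩ := (Matrix.mulVec_surjective_iff_isUnit.2 h.isUnit_minor) fun i => A (σ i) c
  refine ⟨y, fun r => ?_⟩
  obtain ⟨x, hx⟩ := (Submodule.mem_span_range_iff_exists_fun K).1 (h.span r)
  have hx' : ∀ d, A r d = ∑ i, x i * A (σ i) d := fun d => by
    have := congrFun hx d
    simpa [Finset.sum_apply] using this.symm
  have hy' : ∀ i, A (σ i) c = ∑ k, y k * A (σ i) (γ k) := fun i => by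
    have := congrFun hy i
    simpa [Matrix.mulVec, dotProduct, mul_comm] using this.symm
  rw [hx' c]
  simp only [hy', hx' (γ _), Finset.mul_sum]
  rw [Finset.sum_comm]
  exact Finset.sum_congr rfl fun k _ => Finset.sum_congr rfl fun i _ => by ring

theorem top_le_span_rowVec (h : IsTriangularSelection A σ γ) :
    ⊤ ≤ Submodule.span K (range fun i => rowVec A (σ i)) := by
  rw [top_le_iff]
  apply Submodule.map_injective_of_injective (rowSpace A).injective_subtype
  rw [Submodule.map_span, Submodule.map_top, Submodule.range_subtype, ← range_comp]
  apply le_antisymm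
  · rw [Submodule.span_le]
    rintro _ ⟨i, rfl⟩
    exact (rowVec A (σ i)).2
  · refine Submodule.span_le.2 ?_
    rintro _ ⟨r, rfl⟩
    exact h.span r

theorem top_le_span_colVec (h : IsTriangularSelection A σ γ) :
    ⊤ ≤ Submodule.span K (range fun i => colVec A (γ i)) := by
  rw [top_le_iff]
  apply Submodule.map_injective_of_injective (colSpace A).injective_subtype
  rw [Submodule.map_span, Submodule.map_top, Submodule.range_subtype, ← range_comp]
  apply le_antisymm
  · rw [Submodule.span_le]
    rintro _ ⟨i, rfl⟩
    exact (colVec A (γ i)).2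
  · refine Submodule.span_le.2 ?_
    rintro _ ⟨c, rfl⟩
    obtain ⟨y, hy⟩ := h.exists_col_eq c
    refine (Submodule.mem_span_range_iff_exists_fun K).2 ⟨y, ?_⟩
    funext r
    simp [hy r, colVec, Finset.sum_apply]

/-- The basis of the row space that consists of the selected rows. -/
noncomputable def rowBasis (h : IsTriangularSelection A σ γ) :
    Module.Basis (Fin m) K (rowSpace A) :=
  .mk h.linearIndependent_rowVec h.top_le_span_rowVec

/-- The basis of the column space that consists of the selected columns. -/
noncomputable def colBasis (h : IsTriangularSelection A σ γ) :
    Module.Basis (Fin m) K (colSpace A) :=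
  .mk h.linearIndependent_colVec h.top_le_span_colVec

theorem rowBasis_apply (h : IsTriangularSelection A σ γ) (i : Fin m) :
    h.rowBasis i = rowVec A (σ i) := by simp [rowBasis]

theorem colBasis_apply (h : IsTriangularSelection A σ γ) (i : Fin m) :
    h.colBasis i = colVec A (γ i) := by simp [colBasis]

/-- The pairing of the row space and the column space induced by the matrix. -/
noncomputable def pairing (h : IsTriangularSelection A σ γ) :
    rowSpace A →ₗ[K] colSpace A →ₗ[K] K :=
  (h.colBasis.constr K).toLinearMap ∘ₗ
    LinearMap.pi fun k => LinearMap.proj (γ k) ∘ₗ (rowSpace A).subtype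

theorem pairing_colBasis (h : IsTriangularSelection A σ γ) (x : rowSpace A) (k : Fin m) :
    h.pairing x (h.colBasis k) = (x : C → K) (γ k) := by
  simp [pairing]

/-- The definition prescribes values on the selected columns only. They propagate to all columns
because the coefficients in `exists_col_eq` do not depend on the row. -/
theorem pairing_rowVec_colVec (h : IsTriangularSelection A σ γ) (r : R) (c : C) :
    h.pairing (rowVec A r) (colVec A c) = A r c := by
  obtain ⟨y, hy⟩ := h.exists_col_eq c
  have : colVec A c = ∑ k, y k • h.colBasis k := by
    apply Subtype.ext
    funext r
    simp [hy r, h.colBasis_apply, colVec, Finset.sum_apply]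
  rw [this, map_sum, hy r]
  simp only [map_smul, h.pairing_colBasis, smul_eq_mul]
  rfl

/-- In the two bases the pairing has the selected minor as its matrix, which is invertible. -/
theorem isPerfPair_pairing (h : IsTriangularSelection A σ γ) : h.pairing.IsPerfPair := by
  have := Module.Finite.of_basis h.rowBasis
  have := Module.Finite.of_basis h.colBasis
  apply LinearMap.IsPerfPair.of_injective
  · rw [← LinearMap.ker_eq_bot, LinearMap.ker_eq_bot']
    intro x hx
    rw [← h.rowBasis.sum_repr x]
    have h1 : Matrix.vecMul (h.rowBasis.repr x) (A.submatrix σ γ) = 0 := by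
      funext k
      have h2 := LinearMap.congr_fun hx (h.colBasis k)
      rw [← h.rowBasis.sum_repr x] at h2
      simpa [h.rowBasis_apply, h.colBasis_apply, h.pairing_rowVec_colVec, Matrix.vecMul,
        dotProduct] using h2
    have h2 := Matrix.vecMul_injective_of_isUnit h.isUnit_minor
      (h1.trans (Matrix.zero_vecMul _).symm)
    exact Finset.sum_eq_zero fun i _ => by rw [congrFun h2 i]; simp
  · rw [← LinearMap.ker_eq_bot, LinearMap.ker_eq_bot']
    intro x hx
    rw [← h.colBasis.sum_repr x]
    have h1 : Matrix.mulVec (A.submatrix σ γ) (h.colBasis.repr x) = 0 := by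
      funext k
      have h2 := LinearMap.congr_fun hx (h.rowBasis k)
      rw [← h.colBasis.sum_repr x] at h2
      simpa [h.rowBasis_apply, h.colBasis_apply, h.pairing_rowVec_colVec, Matrix.mulVec,
        dotProduct, mul_comm] using h2
    have h2 := Matrix.mulVec_injective_of_isUnit h.isUnit_minor
      (h1.trans (Matrix.mulVec_zero _).symm)
    exact Finset.sum_eq_zero fun i _ => by rw [congrFun h2 i]; simp

/-- The selected rows and columns form a triangular pair of bases. -/
theorem exists_isTriangularPair (h : IsTriangularSelection A σ γ) {S : Set R} {G : Set C}
    (hS : range σ = S) (hG : range γ = G) :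
    ∃ (c : Module.Basis G K (colSpace A)) (b : Module.Basis S K (rowSpace A)),
      (∀ γ, c γ = colVec A γ) ∧ (∀ σ, b σ = rowVec A σ) ∧
      ∃ p : rowSpace A →ₗ[K] colSpace A →ₗ[K] K,
        (∀ r c, p (rowVec A r) (colVec A c) = A r c) ∧
        ∃ (m : ℕ) (σ : S ≃ Fin m) (γ : G ≃ Fin m),
          IsTriangularPair p (b.reindex σ) (c.reindex γ) := by
  subst hS hG
  let f := Equiv.ofInjective σ h.injective_left
  let g := Equiv.ofInjective γ h.injective_right
  refine ⟨h.colBasis.reindex g, h.rowBasis.reindex f, ?_, ?_, h.pairing,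
    h.pairing_rowVec_colVec, m, f.symm, g.symm, h.isPerfPair_pairing, ?_, ?_⟩
  · rintro ⟨_, i, rfl⟩
    rw [Module.Basis.reindex_apply, h.colBasis_apply]
    congr 2
    exact h.injective_right (by simp [g])
  · rintro ⟨_, i, rfl⟩
    rw [Module.Basis.reindex_apply, h.rowBasis_apply]
    congr 2
    exact h.injective_left (by simp [f])
  · intro i k hik
    simp [h.rowBasis_apply, h.colBasis_apply, h.pairing_rowVec_colVec, h.upper i k hik]
  · intro i
    simp [h.rowBasis_apply, h.colBasis_apply, h.pairing_rowVec_colVec, h.diag i]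

end IsTriangularSelection

end TriangularMatrices

/-! ### Rays and nearest points -/

section Rays

variable {V : Type*} [NormedAddCommGroup V] [NormedSpace ℝ V]

theorem mem_openRay_iff {a x y : V} : y ∈ openRay a x ↔ ∃ r : ℝ, 0 < r ∧ y - a = r • (x - a) := by
  simp only [openRay, mem_image, mem_Ioi, AffineMap.lineMap_apply, vsub_eq_sub, vadd_eq_add]
  exact exists_congr fun r => and_congr_right fun _ =>
    ⟨fun h => by rw [← h]; abel, fun h => by rw [← h]; abel⟩

theorem self_mem_openRay (a x : V) : x ∈ openRay a x :=
  mem_openRay_iff.2 ⟨1, one_pos, (one_smul _ _).symm⟩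

theorem openRay_symm {a x y : V} (h : y ∈ openRay a x) : x ∈ openRay a y := by
  obtain ⟨r, hr, h⟩ := mem_openRay_iff.1 h
  exact mem_openRay_iff.2 ⟨r⁻¹, inv_pos.2 hr, by rw [h, smul_smul, inv_mul_cancel₀ hr.ne', one_smul]⟩

theorem openRay_trans {a x y z : V} (h : y ∈ openRay a x) (h' : z ∈ openRay a y) :
    z ∈ openRay a x := by
  obtain ⟨r, hr, h⟩ := mem_openRay_iff.1 h
  obtain ⟨s, hs, h'⟩ := mem_openRay_iff.1 h'
  exact mem_openRay_iff.2 ⟨s * r, mul_pos hs hr, by rw [h', h, smul_smul]⟩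

theorem mem_segment_iff_exists_sub_eq {a y z : V} :
    y ∈ segment ℝ a z ↔ ∃ r : ℝ, 0 ≤ r ∧ r ≤ 1 ∧ y - a = r • (z - a) := by
  rw [segment_eq_image']
  simp only [mem_image, mem_Icc]
  exact exists_congr fun r => by
    rw [and_assoc]
    exact and_congr_right fun _ => and_congr_right fun _ =>
      ⟨fun h => by rw [← h]; abel, fun h => by rw [← h]; abel⟩

theorem eq_of_mem_segment_of_mem_segment {a y z : V} (h : y ∈ segment ℝ a z)
    (h' : z ∈ segment ℝ a y) : y = z := by
  obtain ⟨r, hr0, hr1, h⟩ := mem_segment_iff_exists_sub_eq.1 h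
  obtain ⟨s, hs0, hs1, h'⟩ := mem_segment_iff_exists_sub_eq.1 h'
  by_cases hz : z - a = 0
  · rw [hz, smul_zero] at h
    exact sub_left_injective (h.trans hz.symm)
  · have h1 : (s * r - 1) • (z - a) = 0 := by
      rw [sub_smul, mul_smul, ← h, ← h', one_smul, sub_self]
    rcases smul_eq_zero.1 h1 with h2 | h2
    · have : r = 1 := by nlinarith
      rw [this, one_smul] at h
      exact sub_left_injective h
    · exact absurd h2 hz

theorem exists_isNearestOnRay {E : Set V} (hE : E.Finite) {a x z : V} (hz : z ∈ E)
    (hzx : z ∈ openRay a x) : ∃ y, IsNearestOnRay E a x y := by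
  have hfin : (E ∩ openRay a x).Finite := hE.subset inter_subset_left
  obtain ⟨y, ⟨hyE, hyx⟩, hmin⟩ := exists_min_image (E ∩ openRay a x) (fun y => ‖y - a‖) hfin
    ⟨z, hz, hzx⟩
  refine ⟨y, hyE, hyx, fun w hw hwx => ?_⟩
  obtain ⟨r, hr, h⟩ := mem_openRay_iff.1 (openRay_trans (openRay_symm hwx) hyx)
  rw [mem_segment_iff_exists_sub_eq]
  by_cases hwa : w - a = 0
  · exact ⟨0, le_rfl, zero_le_one, by rw [h, hwa, smul_zero, smul_zero]⟩
  refine ⟨r, hr.le, ?_, h⟩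
  have h1 := hmin w ⟨hw, hwx⟩
  simp only [h, norm_smul, Real.norm_of_nonneg hr.le] at h1
  exact le_of_mul_le_mul_right (by simpa using h1) (norm_pos_iff.2 hwa)

theorem IsNearestOnRay.unique {E : Set V} {a x x' y y' : V} (h : IsNearestOnRay E a x y)
    (h' : IsNearestOnRay E a x' y') (hx : x' ∈ openRay a x) : y = y' :=
  eq_of_mem_segment_of_mem_segment (h.2.2 y' h'.1 (openRay_trans hx h'.2.1))
    (h'.2.2 y h.1 (openRay_trans (openRay_symm hx) h.2.1))

theorem IsNearestOnRay.congr {E : Set V} {a x x' y : V} (h : IsNearestOnRay E a x y)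
    (hx : x' ∈ openRay a x) : IsNearestOnRay E a x' y :=
  ⟨h.1, openRay_trans (openRay_symm hx) h.2.1, fun z hz hzx => h.2.2 z hz (openRay_trans hx hzx)⟩

theorem IsNearestOnRay.self {E : Set V} {a x y : V} (h : IsNearestOnRay E a x y) :
    IsNearestOnRay E a y y :=
  h.congr h.2.1

theorem isNearestOnRay_nearest {E : Set V} (hE : E.Finite) {a x z : V} (hz : z ∈ E)
    (hzx : z ∈ openRay a x) : IsNearestOnRay E a x (nearest E a x) :=
  Classical.epsilon_spec (exists_isNearestOnRay hE hz hzx)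

end Rays

/-! ### Separated orders and sections by hyperplanes -/

/-- The points that come after `e k`. -/
def laterPoints {V : Type*} {N : ℕ} (e : Fin N → V) (k : Fin N) : Set V := e '' Ioi k

theorem laterPoints_subset_range {V : Type*} {N : ℕ} {e : Fin N → V} (k : Fin N) :
    laterPoints e k ⊆ range e := image_subset_range _ _

section SeparatedOrder

variable {V : Type*} [NormedAddCommGroup V] [NormedSpace ℝ V] {N : ℕ} {e : Fin N → V}

theorem IsSeparatedOrder.notMem_convexHull (he : IsSeparatedOrder e) {j k : Fin N} (hjk : j ≤ k) :
    e j ∉ convexHull ℝ (laterPoints e k) := fun h =>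
  disjoint_left.1 (he k) (subset_convexHull ℝ _ ⟨j, hjk, rfl⟩) h

theorem IsSeparatedOrder.ne (he : IsSeparatedOrder e) {k : Fin N} {x : V}
    (hx : x ∈ laterPoints e k) : x ≠ e k := by
  rintro rfl
  exact he.notMem_convexHull le_rfl (subset_convexHull ℝ _ hx)

/-- A linear functional that is positive on the directions from `e k` to the later points. -/
theorem IsSeparatedOrder.exists_pos (he : IsSeparatedOrder e) (k : Fin N) :
    ∃ g : V →ₗ[ℝ] ℝ, ∀ x ∈ laterPoints e k, 0 < g (x - e k) := by
  obtain ⟨g, u, hu, hg⟩ := geometric_hahn_banach_point_closed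
    (convex_convexHull ℝ (laterPoints e k))
    (((toFinite (Ioi k)).image e).isClosed_convexHull ℝ)
    (he.notMem_convexHull le_rfl)
  refine ⟨g.toLinearMap, fun x hx => ?_⟩
  have := hg x (subset_convexHull ℝ _ hx)
  simp only [ContinuousLinearMap.coe_coe, map_sub]
  linarith

/-- A nearest point on a ray through a later point is a later point. -/
theorem IsSeparatedOrder.mem_laterPoints (he : IsSeparatedOrder e) {k : Fin N} {x y : V}
    (hx : x ∈ laterPoints e k) (hy : IsNearestOnRay (range e) (e k) x y) :
    y ∈ laterPoints e k := by
  obtain ⟨i, hi, rfl⟩ := hx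
  obtain ⟨⟨j, rfl⟩, hray, hmin⟩ := hy
  rcases lt_trichotomy j k with hjk | rfl | hjk
  -- An earlier point `e j` would lie between `e k` and `e i`, which both come after it, against the
  -- order condition at `j`.
  · refine absurd (?_ : e j ∈ convexHull ℝ (laterPoints e j)) (he.notMem_convexHull le_rfl)
    exact segment_subset_convexHull (mem_image_of_mem e hjk)
      (mem_image_of_mem e (hjk.trans (mem_Ioi.1 hi)))
      (hmin (e i) (mem_range_self i) (self_mem_openRay _ _))
  · obtain ⟨r, hr, h⟩ := mem_openRay_iff.1 hray
    rw [sub_self] at h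
    rcases smul_eq_zero.1 h.symm with h | h
    · exact absurd h hr.ne'
    · exact absurd (sub_eq_zero.1 h) (he.ne ⟨i, hi, rfl⟩)
  · exact ⟨j, hjk, rfl⟩

theorem IsSeparatedOrder.exists_nearest (he : IsSeparatedOrder e) {k : Fin N} {x : V}
    (hx : x ∈ laterPoints e k) :
    ∃ y ∈ laterPoints e k, IsNearestOnRay (range e) (e k) x y := by
  obtain ⟨y, hy⟩ := exists_isNearestOnRay (finite_range e) (laterPoints_subset_range k hx)
    (self_mem_openRay (e k) x)
  exact ⟨y, he.mem_laterPoints hx hy, hy⟩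

variable {k : Fin N} {f : V →ᵃ[ℝ] ℝ}

theorem exists_mem_openRay_of_mem_sectionPoints {x : V} (hx : x ∈ sectionPoints e k f) :
    ∃ y ∈ laterPoints e k, y ∈ openRay (e k) x := by
  obtain ⟨-, i, hi, hx⟩ := hx
  refine ⟨e i, ⟨i, hi, rfl⟩, openRay_symm ?_⟩
  rw [openSegment_eq_image'] at hx
  obtain ⟨r, hr, rfl⟩ := hx
  exact mem_openRay_iff.2 ⟨r, hr.1, by simp⟩

theorem Separates.exists_mem_sectionPoints (hf : Separates e k f) {y : V}
    (hy : y ∈ laterPoints e k) : ∃ x ∈ sectionPoints e k f, y ∈ openRay (e k) x := by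
  obtain ⟨i, hi, rfl⟩ := hy
  have h0 := hf.1 k le_rfl
  have h1 := hf.2 i hi
  have hd : 0 < f (e i) - f (e k) := by linarith
  have hr : 0 < -f (e k) / (f (e i) - f (e k)) := div_pos (by linarith) hd
  have hr1 : -f (e k) / (f (e i) - f (e k)) < 1 := (div_lt_one hd).2 (by linarith)
  refine ⟨AffineMap.lineMap (e k) (e i) (-f (e k) / (f (e i) - f (e k))), ⟨?_, i, hi, ?_⟩,
    openRay_symm ⟨_, hr, rfl⟩⟩
  · rw [AffineMap.apply_lineMap, AffineMap.lineMap_apply]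
    simp only [vsub_eq_sub, smul_eq_mul, vadd_eq_add]
    field_simp
    ring
  · rw [openSegment_eq_image_lineMap]
    exact ⟨_, ⟨hr, hr1⟩, rfl⟩

/-- The ray through a section point contains a later point, so the choice in `nearest` is a genuine
one. -/
theorem IsSeparatedOrder.nearest_sectionPoints (he : IsSeparatedOrder e) {x : V}
    (hx : x ∈ sectionPoints e k f) :
    IsNearestOnRay (range e) (e k) x (nearest (range e) (e k) x) ∧
      nearest (range e) (e k) x ∈ laterPoints e k := by
  obtain ⟨y, hy, hyx⟩ := exists_mem_openRay_of_mem_sectionPoints hx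
  have h := isNearestOnRay_nearest (finite_range e) (laterPoints_subset_range k hy) hyx
  exact ⟨h, he.mem_laterPoints hy (h.congr hyx)⟩

/-- Two points of a hyperplane that avoids `a` lie on the same ray from `a` only if they agree. -/
theorem eq_of_mem_openRay {a x y : V} (ha : f a < 0) (hx : f x = 0) (hy : f y = 0)
    (h : y ∈ openRay a x) : y = x := by
  obtain ⟨r, hr, h⟩ := mem_openRay_iff.1 h
  have h1 : ∀ z, f z = f.linear (z - a) + f a := fun z => by
    have := f.linearMap_vsub z a
    simp only [vsub_eq_sub] at this
    rw [this]; ring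
  have h2 := h1 x
  have h3 := h1 y
  rw [h, map_smul, smul_eq_mul] at h3
  have : r = 1 := by
    have h4 : f.linear (x - a) = - f a := by linarith
    rw [h4] at h3
    have : (r - 1) * f a = 0 := by linarith
    rcases mul_eq_zero.1 this with h5 | h5
    · linarith
    · exact absurd h5 ha.ne
  rw [this, one_smul] at h
  exact sub_left_injective h

end SeparatedOrder

/-! ### Cocycles on ordered simplices -/

theorem Fin.cons_comp_succAbove_zero {V : Type*} {m : ℕ} (a : V) (p : Fin m → V) :
    (fun l => (Fin.cons a p : Fin (m + 1) → V) ((0 : Fin (m + 1)).succAbove l)) = p := by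
  funext l
  simp

theorem Fin.cons_comp_succAbove_succ {V : Type*} {m : ℕ} (a : V) (p : Fin (m + 1) → V) (i : Fin (m + 1)) :
    (fun l => (Fin.cons a p : Fin (m + 2) → V) (i.succ.succAbove l)) =
      Fin.cons a (fun l => p (i.succAbove l)) := by
  funext l
  refine Fin.cases ?_ (fun l => ?_) l <;> simp

section Cocycles

variable {V : Type*} [NormedAddCommGroup V] [NormedSpace ℝ V] {W : Type*} [AddCommGroup W]

theorem AddSubgroup.mem_of_alternating_sum_mem (S : AddSubgroup W) {m : ℕ} (g : Fin m → W)
    (h : ∑ i : Fin m, (-1 : ℤ) ^ (i : ℕ) • g i ∈ S) (i : Fin m) (hg : ∀ j, j ≠ i → g j ∈ S) :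
    g i ∈ S := by
  rw [← Finset.add_sum_erase _ _ (Finset.mem_univ i)] at h
  have h1 := (S.add_mem_cancel_right (S.sum_mem fun j hj =>
    S.zsmul_mem (hg j (Finset.ne_of_mem_erase hj)) _)).1 h
  rcases neg_one_pow_eq_or ℤ (i : ℕ) with h2 | h2
  · simpa [h2] using h1
  · simpa [h2] using h1

theorem not_affineIndependent_of_eq {ι : Type*} {p : ι → V} {i j : ι} (hij : i ≠ j)
    (h : p i = p j) : ¬AffineIndependent ℝ p := fun hp => hij (hp.injective h)

theorem not_affineIndependent_of_mem_openRay {ι : Type*} {p : ι → V} {i j l : ι} (hil : i ≠ l)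
    (hjl : j ≠ l) (h : p l ∈ openRay (p i) (p j)) : ¬AffineIndependent ℝ p := fun hp => by
  obtain ⟨r, -, hr⟩ := h
  refine hp.notMem_affineSpan_sdiff l univ ?_
  rw [← hr]
  exact AffineMap.lineMap_mem r (subset_affineSpan ℝ _ ⟨i, ⟨mem_univ _, hil⟩, rfl⟩)
    (subset_affineSpan ℝ _ ⟨j, ⟨mem_univ _, hjl⟩, rfl⟩)

/-- A function of `n`-dimensional simplices with (ordered) vertices in `E` that satisfies the
cocycle relations modulo `S`. -/
structure IsCocycleMod (n : ℕ) (E : Set V) (S : AddSubgroup W) (φ : (Fin (n + 1) → V) → W) :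
    Prop where
  degenerate : ∀ p, (∀ i, p i ∈ E) → ¬AffineIndependent ℝ p → φ p ∈ S
  boundary : ∀ p : Fin (n + 2) → V, (∀ i, p i ∈ E) →
    ∑ i : Fin (n + 2), (-1 : ℤ) ^ (i : ℕ) • φ (fun j => p (i.succAbove j)) ∈ S

namespace IsCocycleMod

variable {n : ℕ} {E : Set V} {S : AddSubgroup W} {φ : (Fin (n + 1) → V) → W}

theorem face_mem (h : IsCocycleMod n E S φ) (p : Fin (n + 2) → V) (hp : ∀ i, p i ∈ E)
    (i : Fin (n + 2)) (hj : ∀ j, j ≠ i → φ (fun l => p (j.succAbove l)) ∈ S) :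
    φ (fun l => p (i.succAbove l)) ∈ S :=
  S.mem_of_alternating_sum_mem (fun i => φ (fun l => p (i.succAbove l))) (h.boundary p hp) i hj

/-- A simplex is equivalent to a combination of simplices with a given vertex. -/
theorem mem_of_cons_mem (h : IsCocycleMod n E S φ) {a : V} (ha : a ∈ E) (p : Fin (n + 1) → V)
    (hp : ∀ i, p i ∈ E)
    (hcons : ∀ i, φ (Fin.cons a fun l => p (Fin.succAbove i l)) ∈ S) : φ p ∈ S := by
  have := h.face_mem (Fin.cons a p) (Fin.cases ha hp) 0 fun j hj => by
    obtain ⟨i, rfl⟩ := Fin.exists_succ_eq.2 hj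
    rw [Fin.cons_comp_succAbove_succ]
    exact hcons i
  rwa [Fin.cons_comp_succAbove_zero] at this

/-- A vertex can be moved along a ray from the first vertex, modulo simplices without the first
vertex. -/
theorem cons_mem_of_update (h : IsCocycleMod n E S φ) {a : V} (ha : a ∈ E) {D : Set V}
    (hDE : D ⊆ E) (hD : ∀ p : Fin (n + 1) → V, (∀ i, p i ∈ D) → φ p ∈ S)
    (p : Fin n → V) (hp : ∀ i, p i ∈ D) (i : Fin n) {y : V} (hy : y ∈ D)
    (hray : y ∈ openRay a (p i))
    (hup : φ (Fin.cons a (Function.update p i y)) ∈ S) : φ (Fin.cons a p) ∈ S := by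
  set r : Fin (n + 1) → V := Fin.insertNth i.succ y p with hr
  have hrD : ∀ j, r j ∈ D := fun j => by
    rcases Fin.eq_self_or_eq_succAbove i.succ j with rfl | ⟨l, rfl⟩
    · simpa [hr] using hy
    · simpa [hr] using hp l
  have hr1 : (fun l => r (i.succ.succAbove l)) = p := by
    funext l
    simp [hr]
  have hr1' : ∀ l, r (i.succ.succAbove l) = p l := congrFun hr1
  have hri : r i.succ = y := by simp [hr]
  have hrc : r i.castSucc = p i := by
    rw [← hr1']
    simp
  have hr2 : (fun l => r (i.castSucc.succAbove l)) = Function.update p i y := by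
    funext l
    rcases lt_trichotomy l i with hl | rfl | hl
    · rw [Function.update_of_ne hl.ne, Fin.succAbove_of_castSucc_lt _ _ (by simpa using hl), ← hr1',
        Fin.succAbove_of_castSucc_lt _ _ ((Fin.castSucc_lt_castSucc_iff.2 hl).trans
          Fin.castSucc_lt_succ)]
    · simp [hri]
    · rw [Function.update_of_ne hl.ne', Fin.succAbove_of_le_castSucc _ _ (by simpa using hl.le),
        ← hr1', Fin.succAbove_of_le_castSucc _ _ (by
          rw [Fin.le_def]; simp only [Fin.val_succ, Fin.val_castSucc]; omega)]
  have := h.face_mem (Fin.cons a r) (Fin.cases ha fun j => hDE (hrD j)) i.succ.succ fun j hj => by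
    rcases Fin.eq_zero_or_eq_succ j with rfl | ⟨j, rfl⟩
    · rw [Fin.cons_comp_succAbove_zero]
      exact hD r hrD
    rw [Fin.cons_comp_succAbove_succ]
    by_cases hji : j = i.castSucc
    · rw [hji, hr2]
      exact hup
    obtain ⟨u, hu⟩ := Fin.exists_succAbove_eq (Ne.symm hji)
    obtain ⟨v, hv⟩ := Fin.exists_succAbove_eq (x := i.succ) (y := j) fun h' => hj (by rw [h'])
    refine h.degenerate _ (Fin.cases ha fun l => hDE (hrD _)) ?_
    have huv : u ≠ v := by
      rintro rfl
      rw [hu] at hv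
      exact (Fin.castSucc_lt_succ (i := i)).ne hv
    exact not_affineIndependent_of_mem_openRay (i := 0) (j := u.succ) (l := v.succ)
      (Fin.succ_ne_zero _).symm (fun h' => huv (Fin.succ_injective _ h'))
      (by simpa [hu, hv, hri, hrc] using hray)
  rwa [Fin.cons_comp_succAbove_succ, hr1] at this

end IsCocycleMod

end Cocycles

/-! ### Reduction to cones over nearest later points -/

section Spanning

variable {V : Type*} [NormedAddCommGroup V] [NormedSpace ℝ V] {W : Type*} [AddCommGroup W]
  {n N : ℕ} {e : Fin N → V} {S : AddSubgroup W} {φ : (Fin (n + 1) → V) → W}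

/-- It suffices to consider simplices with first vertex `e k`, all other vertices being later points
that are nearest to `e k` on their rays. -/
theorem IsSeparatedOrder.cocycle_mem (he : IsSeparatedOrder e)
    (hφ : IsCocycleMod n (range e) S φ)
    (H : ∀ k, (∀ p : Fin (n + 1) → V, (∀ i, p i ∈ laterPoints e k) → φ p ∈ S) →
      ∀ p : Fin n → V, (∀ i, p i ∈ laterPoints e k) →
        (∀ i, IsNearestOnRay (range e) (e k) (p i) (p i)) → φ (Fin.cons (e k) p) ∈ S)
    (p : Fin (n + 1) → V) (hp : ∀ i, p i ∈ range e) : φ p ∈ S := by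
  -- Descending induction on the lower bound `m` for the indices of the vertices, with `d = N - m`.
  have key : ∀ d m : ℕ, m + d = N → ∀ p : Fin (n + 1) → V,
      (∀ i, ∃ j : Fin N, m ≤ j ∧ p i = e j) → φ p ∈ S := by
    intro d
    induction d with
    | zero =>
      intro m hm p hp
      obtain ⟨j, hj, -⟩ := hp 0
      omega
    | succ d ih =>
      intro m hm p hp
      let k : Fin N := ⟨m, by omega⟩
      have hlater : ∀ p : Fin (n + 1) → V, (∀ i, p i ∈ laterPoints e k) → φ p ∈ S := by
        intro p hp
        refine ih (m + 1) (by omega) p fun i => ?_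
        obtain ⟨j, hj, h⟩ := hp i
        exact ⟨j, hj, h.symm⟩
      -- The set `s` holds the positions whose vertices may not yet be nearest on their rays; they
      -- are moved one at a time.
      have hcons : ∀ s : Finset (Fin n), ∀ p : Fin n → V, (∀ i, p i ∈ laterPoints e k) →
          (∀ i, i ∉ s → IsNearestOnRay (range e) (e k) (p i) (p i)) →
          φ (Fin.cons (e k) p) ∈ S := by
        intro s
        induction s using Finset.induction with
        | empty => exact fun p hp hn => H k hlater p hp fun i => hn i (Finset.notMem_empty i)
        | insert i s his ihs =>
          intro p hp hn
          obtain ⟨y, hy, hyn⟩ := he.exists_nearest (hp i)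
          refine hφ.cons_mem_of_update (mem_range_self k) (laterPoints_subset_range k) hlater p hp i
            hy hyn.2.1 (ihs _ (fun j => ?_) fun j hj => ?_)
          · by_cases hji : j = i
            · subst hji; simpa using hy
            · simpa [hji] using hp j
          · by_cases hji : j = i
            · subst hji; simpa using hyn.self
            · simpa [hji] using hn j (by simp [hji, hj])
      refine hφ.mem_of_cons_mem (mem_range_self k) p (fun i => ?_) fun i => ?_
      · obtain ⟨j, -, h⟩ := hp i
        exact ⟨j, h.symm⟩
      -- If `e k` is already a vertex, the cone repeats it and is degenerate; otherwise all vertices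
      -- are later points.
      by_cases hk : ∃ l, p (i.succAbove l) = e k
      · obtain ⟨l, hl⟩ := hk
        have hpE : ∀ l, p l ∈ range e := fun l => by
          obtain ⟨j, -, h⟩ := hp l
          exact ⟨j, h.symm⟩
        exact hφ.degenerate _ (Fin.cases (mem_range_self k) fun l => hpE _) <|
          not_affineIndependent_of_eq (i := 0) (j := l.succ) (Fin.succ_ne_zero l).symm
            (by simp [hl])
      · refine hcons Finset.univ _ (fun l => ?_) fun l hl => absurd (Finset.mem_univ l) hl
        obtain ⟨j, hj, h⟩ := hp (i.succAbove l)
        refine ⟨j, lt_of_le_of_ne (Fin.le_def.2 hj) ?_, h.symm⟩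
        rintro rfl
        exact hk ⟨l, h⟩
  refine key N 0 (zero_add N) p fun i => ?_
  obtain ⟨j, hj⟩ := hp i
  exact ⟨j, Nat.zero_le _, hj.symm⟩

end Spanning

/-! ### Open angles and affine independence of cones -/

section Angles

variable {V : Type*} [NormedAddCommGroup V] [NormedSpace ℝ V]

theorem mem_openAngle_iff {a x y z : V} :
    z ∈ openAngle a x y ↔ ∃ s t : ℝ, 0 < s ∧ 0 < t ∧ z - a = s • (x - a) + t • (y - a) := by
  refine exists_congr fun s => exists_congr fun t => and_congr_right fun _ =>
    and_congr_right fun _ => ?_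
  rw [sub_eq_iff_eq_add', add_assoc]

theorem openAngle_comm (a x y : V) : openAngle a x y = openAngle a y x := by
  ext z
  rw [mem_openAngle_iff, mem_openAngle_iff, exists_comm]
  exact exists_congr fun s => exists_congr fun t => by rw [add_comm]; tauto

theorem mem_openAngle_of_mem_openRay {a x y z w : V} (hz : z ∈ openAngle a x y)
    (hw : w ∈ openRay a z) : w ∈ openAngle a x y := by
  obtain ⟨s, t, hs, ht, h⟩ := mem_openAngle_iff.1 hz
  obtain ⟨r, hr, h'⟩ := mem_openRay_iff.1 hw
  exact mem_openAngle_iff.2 ⟨r * s, r * t, mul_pos hr hs, mul_pos hr ht, by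
    rw [h', h, smul_add, smul_smul, smul_smul]⟩

theorem openAngle_subset {a x y z : V} (hz : z ∈ openAngle a x y) :
    openAngle a x z ⊆ openAngle a x y := by
  intro w hw
  obtain ⟨s, t, hs, ht, h⟩ := mem_openAngle_iff.1 hz
  obtain ⟨s', t', hs', ht', h'⟩ := mem_openAngle_iff.1 hw
  exact mem_openAngle_iff.2 ⟨s' + t' * s, t' * t, by positivity, by positivity, by
    rw [h', h]; module⟩

/-- Makes the inclusion `openAngle_subset` strict on points of `E`, so that subdividing an angle
lowers the number of points inside it. -/
theorem notMem_openAngle_of_linearIndependent {a x y z : V}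
    (hxy : LinearIndependent ℝ ![x - a, y - a]) (hz : z ∈ openAngle a x y) :
    z ∉ openAngle a x z := by
  intro hw
  obtain ⟨s, t, hs, ht, h⟩ := mem_openAngle_iff.1 hz
  obtain ⟨s', t', hs', ht', h'⟩ := mem_openAngle_iff.1 hw
  rw [h] at h'
  have h1 : (s - (s' + t' * s)) • (x - a) + (t - t' * t) • (y - a) = 0 := by
    rw [← sub_eq_zero] at h'
    rw [← h']
    module
  obtain ⟨h2, h3⟩ := LinearIndependent.pair_iff.1 hxy _ _ h1
  have : t' = 1 := by
    have : t * (1 - t') = 0 := by linarith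
    rcases mul_eq_zero.1 this with h4 | h4 <;> linarith
  subst this
  linarith

theorem affineIndependent_triple_iff {a x y : V} :
    AffineIndependent ℝ ![a, x, y] ↔ LinearIndependent ℝ ![x - a, y - a] := by
  rw [affineIndependent_iff_linearIndependent_vsub ℝ _ (0 : Fin 3),
    ← linearIndependent_equiv (finSuccAboveEquiv (0 : Fin 3))]
  apply iff_of_eq
  congr 1
  funext i
  fin_cases i <;> rfl

end Angles

section Cones

variable {V : Type*} [NormedAddCommGroup V] [NormedSpace ℝ V] {m : ℕ} {a : V} {x y : Fin m → V}

theorem affineIndependent_cons_iff :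
    AffineIndependent ℝ (Fin.cons a x : Fin (m + 1) → V) ↔
      LinearIndependent ℝ fun i => x i - a := by
  rw [affineIndependent_iff_linearIndependent_vsub ℝ _ (0 : Fin (m + 1)),
    ← linearIndependent_equiv (finSuccAboveEquiv (0 : Fin (m + 1)))]
  apply iff_of_eq
  congr 1

theorem affineIndependent_of_cons
    (h : AffineIndependent ℝ (Fin.cons a x : Fin (m + 1) → V)) : AffineIndependent ℝ x := by
  simpa [Function.comp_def] using h.comp_embedding (Fin.succEmb m)

theorem affineIndependent_cons_of_mem_openRay (hray : ∀ i, y i ∈ openRay a (x i))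
    (h : AffineIndependent ℝ (Fin.cons a x : Fin (m + 1) → V)) :
    AffineIndependent ℝ (Fin.cons a y : Fin (m + 1) → V) := by
  rw [affineIndependent_cons_iff] at h ⊢
  choose r hr hy using fun i => mem_openRay_iff.1 (hray i)
  have := h.units_smul fun i => Units.mk0 (r i) (hr i).ne'
  convert this using 1
  funext i
  exact hy i

/-- The linear part of `f` has the same nonzero value `-f a` on all `x i - a`, so the coefficients
of a linear relation between these vectors sum to zero and form an affine relation between the `x
i`. -/
theorem affineIndependent_cons_of_hyperplane {f : V →ᵃ[ℝ] ℝ} (ha : f a ≠ 0)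
    (hf : ∀ i, f (x i) = 0) (h : AffineIndependent ℝ x) :
    AffineIndependent ℝ (Fin.cons a x : Fin (m + 1) → V) := by
  rw [affineIndependent_cons_iff, Fintype.linearIndependent_iff]
  intro g hg
  have hlin : ∀ i, f.linear (x i - a) = -f a := fun i => by
    have := f.linearMap_vsub (x i) a
    simp only [vsub_eq_sub] at this
    rw [this, hf i, zero_sub]
  have hsum : ∑ i, g i = 0 := by
    have := congrArg f.linear hg
    simp only [map_sum, map_smul, hlin, smul_eq_mul, map_zero, ← Finset.sum_mul] at this
    exact (mul_eq_zero.1 this).resolve_right (neg_ne_zero.2 ha)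
  have hcomb : ∑ i, g i • x i = 0 := by
    simpa only [smul_sub, Finset.sum_sub_distrib, ← Finset.sum_smul, hsum, zero_smul, sub_zero]
      using hg
  exact fun i => affineIndependent_iff.1 h Finset.univ g hsum hcomb i (Finset.mem_univ i)

end Cones

/-! ### The constructed simplices determine a cocycle -/

section Spanning

variable {V : Type*} [NormedAddCommGroup V] [NormedSpace ℝ V] {W : Type*} [AddCommGroup W]
  {n N : ℕ} {e : Fin N → V} {S : AddSubgroup W}

/-- Induction on the number of later points in the open angle. If there is none, the triangle is a
chosen one or degenerate. Otherwise a nearest point `z` in the angle splits it into two smaller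
angles, at the cost of the triangle `x, z, y` of later points. -/
theorem IsSeparatedOrder.plane_cocycle_mem (he : IsSeparatedOrder e)
    {φ : (Fin 3 → V) → W} (hφ : IsCocycleMod 2 (range e) S φ) (k : Fin N)
    (hT : ∀ s ∈ planeSimplices e k, ∀ p, range p = s → φ p ∈ S)
    (hlater : ∀ p : Fin 3 → V, (∀ i, p i ∈ laterPoints e k) → φ p ∈ S)
    {x y : V} (hx : x ∈ laterPoints e k) (hy : y ∈ laterPoints e k)
    (hnx : IsNearestOnRay (range e) (e k) x x) (hny : IsNearestOnRay (range e) (e k) y y) :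
    φ ![e k, x, y] ∈ S := by
  have key : ∀ (d : ℕ) (x y : V), x ∈ laterPoints e k → y ∈ laterPoints e k →
      IsNearestOnRay (range e) (e k) x x → IsNearestOnRay (range e) (e k) y y →
      (laterPoints e k ∩ openAngle (e k) x y).ncard ≤ d → φ ![e k, x, y] ∈ S := by
    intro d
    induction d with
    | zero =>
      intro x y hx hy hnx hny hd
      by_cases hray : y ∈ openRay (e k) x
      · refine hφ.degenerate _ ?_ (not_affineIndependent_of_mem_openRay (i := 0) (j := 1) (l := 2)
          (by decide) (by decide) hray)
        intro i
        fin_cases i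
        exacts [mem_range_self k, hnx.1, hny.1]
      have hempty := (ncard_eq_zero (((toFinite (Ioi k)).image e).inter_of_left _)).1
        (Nat.le_zero.1 hd)
      obtain ⟨i, hi, rfl⟩ := hx
      obtain ⟨j, hj, rfl⟩ := hy
      refine hT {e k, e i, e j} ⟨i, j, hi, hj, hray, fun l hl hmem => ?_, hnx, hny, rfl⟩ _ ?_
      · exact (hempty ▸ (⟨⟨l, hl, rfl⟩, hmem⟩ : e l ∈ laterPoints e k ∩ _) : e l ∈ (∅ : Set V))
      · ext z
        simp only [Matrix.range_cons, Matrix.range_empty, union_empty, mem_union,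
          mem_singleton_iff, mem_insert_iff]
    | succ d ih =>
      intro x y hx hy hnx hny hd
      have hxyE : ∀ i, (![e k, x, y] : Fin 3 → V) i ∈ range e := by
        intro i
        fin_cases i
        exacts [mem_range_self k, hnx.1, hny.1]
      by_cases hind : AffineIndependent ℝ ![e k, x, y]
      swap
      · exact hφ.degenerate _ hxyE hind
      have hlin := affineIndependent_triple_iff.1 hind
      have hlin' : LinearIndependent ℝ ![y - e k, x - e k] := LinearIndependent.pair_symm_iff.1 hlin
      by_cases hempty : (laterPoints e k ∩ openAngle (e k) x y) = ∅
      · exact ih x y hx hy hnx hny (by rw [hempty]; simp)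
      obtain ⟨z', hz', hz'a⟩ := nonempty_iff_ne_empty.2 hempty
      obtain ⟨z, hz, hzn⟩ := he.exists_nearest hz'
      have hza := mem_openAngle_of_mem_openRay hz'a hzn.2.1
      have hfin : (laterPoints e k ∩ openAngle (e k) x y).Finite :=
        ((toFinite (Ioi k)).image e).inter_of_left _
      have h1 : φ ![e k, x, z] ∈ S := by
        refine ih x z hx hz hnx hzn.self (Nat.le_of_lt_succ (lt_of_lt_of_le ?_ hd))
        exact ncard_lt_ncard ⟨inter_subset_inter_right _ (openAngle_subset hza), fun h =>
          notMem_openAngle_of_linearIndependent hlin hza (h ⟨hz, hza⟩).2⟩ hfin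
      have h2 : φ ![e k, z, y] ∈ S := by
        refine ih z y hz hy hzn.self hny (Nat.le_of_lt_succ (lt_of_lt_of_le ?_ hd))
        rw [openAngle_comm _ x] at hza hfin ⊢
        rw [openAngle_comm _ z]
        exact ncard_lt_ncard ⟨inter_subset_inter_right _ (openAngle_subset hza), fun h =>
          notMem_openAngle_of_linearIndependent hlin' hza (h ⟨hz, hza⟩).2⟩ hfin
      have h3 : φ ![x, z, y] ∈ S := hlater _ fun i => by
        fin_cases i
        exacts [hx, hz, hy]
      have := hφ.face_mem ![e k, x, z, y] (fun i => by
        fin_cases i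
        exacts [mem_range_self k, hnx.1, hzn.1, hny.1]) 2 fun j hj => by
          fin_cases j
          · convert h3 using 2
            funext l; fin_cases l <;> rfl
          · convert h2 using 2
            funext l; fin_cases l <;> rfl
          · exact absurd rfl hj
          · convert h1 using 2
            funext l; fin_cases l <;> rfl
      convert this using 2
      funext l; fin_cases l <;> rfl
  exact key _ x y hx hy hnx hny le_rfl

/-- A cocycle that vanishes modulo `S` on the constructed simplices vanishes modulo `S`. -/
theorem IsConstruction.cocycle_mem {T : Set (Piece V)} (h : IsConstruction n e T)
    {φ : (Fin (n + 1) → V) → W} (hφ : IsCocycleMod n (range e) S φ)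
    (hT : ∀ t ∈ T, ∀ p, range p = t.simplex → φ p ∈ S)
    (p : Fin (n + 1) → V) (hp : ∀ i, p i ∈ range e) : φ p ∈ S := by
  induction h with
  | plane e he c hc =>
    refine he.cocycle_mem hφ (fun k hlater p hp hn => ?_) p hp
    have := he.plane_cocycle_mem hφ k (fun s hs q hq => hT _ ⟨k, s, hs, rfl⟩ q hq) hlater (hp 0)
      (hp 1) (hn 0) (hn 1)
    convert this using 2
    funext l; fin_cases l <;> rfl
  | @step n N e he f hf M e' he' T hT' c hc ih =>
    refine he.cocycle_mem hφ (fun k hlater p hp hn => ?_) p hp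
    have hnear : ∀ x ∈ range (e' k), IsNearestOnRay (range e) (e k) x (nearest (range e) (e k) x) ∧
        nearest (range e) (e k) x ∈ laterPoints e k := fun x hx =>
      he.nearest_sectionPoints (he' k ▸ hx)
    have hsec := fun i => (hf k).exists_mem_sectionPoints (hp i)
    choose x hx hpx using hsec
    -- The vertices are already nearest, so projecting to the hyperplane and lifting back returns
    -- them.
    have hpx' : ∀ i, p i = nearest (range e) (e k) (x i) := fun i =>
      (hn i).unique (hnear (x i) (he' k ▸ hx i)).1 (openRay_symm (hpx i))
    have hk : e k ∈ range e := mem_range_self k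
    -- Coning over the lifted vertices turns `φ` into a cocycle on the section points.
    have := ih k (φ := fun q => φ (Fin.cons (e k) fun i => nearest (range e) (e k) (q i)))
      ⟨fun q hq hdeg => ?_, fun q hq => ?_⟩ (fun t ht q hq => ?_) x (fun i => he' k ▸ hx i)
    · simpa only [← hpx'] using this
    · refine hφ.degenerate _ (Fin.cases hk fun i => (hnear _ (hq i)).1.1) fun hind => hdeg ?_
      have hray := fun i => openRay_symm (hnear _ (hq i)).1.2.1
      exact affineIndependent_of_cons (affineIndependent_cons_of_mem_openRay hray hind)
    -- In the boundary of the cone, the face opposite `e k` has only later vertices and lies in `S`;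
    -- the other faces give minus the boundary sum of the coned function.
    · have := hφ.boundary (Fin.cons (e k) fun i => nearest (range e) (e k) (q i))
        (Fin.cases hk fun i => (hnear _ (hq i)).1.1)
      rw [Fin.sum_univ_succ, Fin.cons_comp_succAbove_zero] at this
      simp only [Fin.cons_comp_succAbove_succ] at this
      rw [S.add_mem_cancel_left (S.zsmul_mem (hlater _ fun i => (hnear _ (hq i)).2) _)] at this
      simpa [pow_succ, Finset.sum_neg_distrib] using this
    · refine hT _ ⟨k, t, ht, rfl⟩ _ ?_
      rw [Fin.range_cons, Piece.lift, ← hq, ← range_comp]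
      rfl

end Spanning

/-! ### Open simplices and central projection -/

section OpenHull

variable {V : Type*} [NormedAddCommGroup V] [NormedSpace ℝ V]

/-- The convex combinations of all points of a finite set with positive weights. -/
def openHull (s : Set V) : Set V :=
  {x | ∃ (F : Finset V) (w : V → ℝ), ↑F = s ∧ (∀ v ∈ F, 0 < w v) ∧ ∑ v ∈ F, w v = 1 ∧
    ∑ v ∈ F, w v • v = x}

theorem openHull_subset_convexHull (s : Set V) : openHull s ⊆ convexHull ℝ s := by
  rintro _ ⟨F, w, rfl, hw, h1, rfl⟩
  exact Finset.mem_convexHull'.2 ⟨w, fun v hv => (hw v hv).le, h1, rfl⟩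

theorem openHull_singleton (a : V) : openHull {a} ⊆ {a} := by
  simpa using openHull_subset_convexHull {a}

theorem intrinsicInterior_convexHull_subset_openHull {s : Set V} (hs : s.Finite) :
    intrinsicInterior ℝ (convexHull ℝ s) ⊆ openHull s := by
  obtain ⟨F, rfl⟩ := hs.exists_finset_coe
  intro y hy
  have hyc := intrinsicInterior_subset hy
  have hne : F.Nonempty := Finset.coe_nonempty.1 (convexHull_nonempty_iff.1 ⟨y, hyc⟩)
  obtain ⟨⟨y, hys⟩, hy, rfl⟩ := mem_intrinsicInterior.1 hy
  have hcard : (0 : ℝ) < F.card := by exact_mod_cast hne.card_pos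
  -- Prolong the segment from the barycentre `c` slightly beyond `y`, staying in the hull. Then `y`
  -- is a proper mixture of that endpoint and `c`, so all its weights are positive.
  set c : V := ∑ v ∈ F, (F.card : ℝ)⁻¹ • v with hc
  have hcF : c ∈ convexHull ℝ (F : Set V) := Finset.mem_convexHull'.2
    ⟨fun _ => (F.card : ℝ)⁻¹, fun _ _ => by positivity, by simp [hcard.ne'], rfl⟩
  have hcs := subset_affineSpan ℝ _ hcF
  let γ : ℝ → affineSpan ℝ (convexHull ℝ (F : Set V)) := fun t =>
    ⟨AffineMap.lineMap c y t, AffineMap.lineMap_mem t hcs hys⟩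
  have hγ : Continuous γ := AffineMap.lineMap_continuous.subtype_mk _
  have hγ1 : γ 1 = ⟨y, hys⟩ := Subtype.ext (AffineMap.lineMap_apply_one c y)
  have hev : ∀ᶠ t in nhds (1 : ℝ), γ t ∈ interior
      ((↑) ⁻¹' convexHull ℝ (F : Set V) : Set (affineSpan ℝ (convexHull ℝ (F : Set V)))) :=
    hγ.continuousAt.eventually_mem (isOpen_interior.mem_nhds (by rwa [hγ1]))
  obtain ⟨t, ht, ht1⟩ := ((hev.filter_mono nhdsWithin_le_nhds).and
    (self_mem_nhdsWithin : Ioi (1 : ℝ) ∈ nhdsWithin 1 (Ioi 1))).exists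
  have ht1 : 1 < t := ht1
  have htF : AffineMap.lineMap c y t ∈ convexHull ℝ (F : Set V) := (interior_subset ht :)
  obtain ⟨w, hw, hw1, hwt⟩ := Finset.mem_convexHull'.1 htF
  have ht' : t⁻¹ < 1 := inv_lt_one_of_one_lt₀ ht1
  have ht0 : 0 < t⁻¹ := by positivity
  refine ⟨F, fun v => t⁻¹ * w v + (1 - t⁻¹) * (F.card : ℝ)⁻¹, rfl, fun v hv => ?_, ?_, ?_⟩
  · have := hw v hv
    have : 0 < (1 - t⁻¹) * (F.card : ℝ)⁻¹ := mul_pos (by linarith) (by positivity)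
    positivity
  · rw [Finset.sum_add_distrib, ← Finset.mul_sum, hw1]
    rw [Finset.sum_const, nsmul_eq_mul]
    field_simp
    ring
  · simp only [add_smul, mul_smul, Finset.sum_add_distrib, ← Finset.smul_sum]
    rw [hwt, ← hc, AffineMap.lineMap_apply, vsub_eq_sub, vadd_eq_add, smul_add, smul_smul,
      inv_mul_cancel₀ (by positivity)]
    module

-- Seen from `a`, the weight of `a` drops out and each other weight is rescaled by a positive
-- factor. The new weights need not sum to one; `eq_add_smul_of_weights` normalises them.
open Classical in
theorem exists_weights_project {a : V} {g : V → V} {F : Finset V} (hg : ∀ x ∈ F, g x ∈ openRay a x)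
    (hinj : InjOn g F) (haF : ∀ x ∈ F, g x ≠ a) {w : V → ℝ}
    (hw : ∑ v ∈ insert a (F.image g), w v = 1) :
    ∃ w' : V → ℝ, (∀ x ∈ F, 0 < w (g x) → 0 < w' x) ∧ (∀ x ∈ F, 0 ≤ w (g x) → 0 ≤ w' x) ∧
      ∑ v ∈ insert a (F.image g), w v • v - a = ∑ x ∈ F, w' x • (x - a) := by
  have : ∀ x, ∃ r : ℝ, 0 < r ∧ (x ∈ F → g x - a = r • (x - a)) := fun x => by
    by_cases hx : x ∈ F
    · obtain ⟨r, hr, h⟩ := mem_openRay_iff.1 (hg x hx)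
      exact ⟨r, hr, fun _ => h⟩
    · exact ⟨1, one_pos, fun h => absurd h hx⟩
  choose r hr hgr using this
  refine ⟨fun x => w (g x) * r x, fun x _ h => mul_pos h (hr x),
    fun x _ h => mul_nonneg h (hr x).le, ?_⟩
  have h1 : ∑ v ∈ insert a (F.image g), w v • v - a =
      ∑ v ∈ insert a (F.image g), w v • (v - a) := by
    simp only [smul_sub, Finset.sum_sub_distrib, ← Finset.sum_smul, hw, one_smul]
  have ha : a ∉ F.image g := fun h => by
    obtain ⟨x, hx, h⟩ := Finset.mem_image.1 h
    exact haF x hx h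
  rw [h1, Finset.sum_insert ha, sub_self, smul_zero, zero_add, Finset.sum_image hinj]
  exact Finset.sum_congr rfl fun x hx => by rw [hgr x hx, mul_smul]

theorem eq_add_smul_of_weights {a y : V} {F : Finset V} {w : V → ℝ}
    (hy : y - a = ∑ x ∈ F, w x • (x - a)) (h0 : 0 < ∑ x ∈ F, w x) :
    ∑ x ∈ F, (w x / ∑ x ∈ F, w x) = 1 ∧
      y ∈ openRay a (∑ x ∈ F, (w x / ∑ x ∈ F, w x) • x) := by
  have h1 : ∑ x ∈ F, (w x / ∑ x ∈ F, w x) = 1 := by rw [← Finset.sum_div, div_self h0.ne']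
  refine ⟨h1, mem_openRay_iff.2 ⟨_, h0, ?_⟩⟩
  have : ∑ x ∈ F, (w x / ∑ x ∈ F, w x) • x - a = ∑ x ∈ F, (w x / ∑ x ∈ F, w x) • (x - a) := by
    simp only [smul_sub, Finset.sum_sub_distrib, ← Finset.sum_smul, h1, one_smul]
  rw [this, hy, Finset.smul_sum]
  exact Finset.sum_congr rfl fun x _ => by rw [smul_smul, mul_div_cancel₀ _ h0.ne']

/-- The central projection from `a` of the open simplex spanned by `a` and points on the rays
through the points of `A`. -/
theorem exists_openHull_of_cone {a : V} {g : V → V} {A : Set V} (hA : A.Finite)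
    (hne : A.Nonempty) (hg : ∀ x ∈ A, g x ∈ openRay a x) (hinj : InjOn g A)
    (haA : ∀ x ∈ A, g x ≠ a) {y : V} (hy : y ∈ openHull (insert a (g '' A))) :
    ∃ y' ∈ openHull A, y ∈ openRay a y' := by
  classical
  obtain ⟨F, rfl⟩ := hA.exists_finset_coe
  obtain ⟨F', w, hF', hw, hw1, rfl⟩ := hy
  have : F' = insert a (F.image g) := by
    apply Finset.coe_injective
    rw [hF']
    simp
  subst this
  obtain ⟨w', hpos, -, h⟩ := exists_weights_project hg hinj haA hw1
  have hpos' : ∀ x ∈ F, 0 < w' x := fun x hx => hpos x hx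
    (hw _ (Finset.mem_insert_of_mem (Finset.mem_image_of_mem g hx)))
  have hsum : 0 < ∑ x ∈ F, w' x := Finset.sum_pos hpos' (Finset.coe_nonempty.1 hne)
  obtain ⟨h1, h2⟩ := eq_add_smul_of_weights h hsum
  exact ⟨_, ⟨F, _, rfl, fun x hx => div_pos (hpos' x hx) hsum, h1, rfl⟩, h2⟩

theorem exists_convexHull_of_cone {a : V} {g : V → V} {A : Set V} (hA : A.Finite)
    (hg : ∀ x ∈ A, g x ∈ openRay a x) (hinj : InjOn g A)
    (haA : ∀ x ∈ A, g x ≠ a) {y : V} (hy : y ∈ convexHull ℝ (insert a (g '' A))) (hya : y ≠ a) :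
    ∃ y' ∈ convexHull ℝ A, y ∈ openRay a y' := by
  classical
  obtain ⟨F, rfl⟩ := hA.exists_finset_coe
  have : (insert a (g '' F) : Set V) = ↑(insert a (F.image g)) := by simp
  rw [this] at hy
  obtain ⟨w, hw, hw1, rfl⟩ := Finset.mem_convexHull'.1 hy
  obtain ⟨w', -, hnonneg, h⟩ := exists_weights_project hg hinj haA hw1
  have hnonneg' : ∀ x ∈ F, 0 ≤ w' x := fun x hx => hnonneg x hx
    (hw _ (Finset.mem_insert_of_mem (Finset.mem_image_of_mem g hx)))
  -- Zero total weight would mean `y = a`, the one point that has no projection.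
  rcases (Finset.sum_nonneg hnonneg').eq_or_lt' with h0 | hsum
  · refine absurd (sub_eq_zero.1 (h.trans ?_)) hya
    exact Finset.sum_eq_zero fun x hx => by
      rw [(Finset.sum_eq_zero_iff_of_nonneg hnonneg').1 h0 x hx, zero_smul]
  obtain ⟨h1, h2⟩ := eq_add_smul_of_weights h hsum
  exact ⟨_, Finset.mem_convexHull'.2 ⟨_, fun x hx => div_nonneg (hnonneg' x hx) hsum.le, h1, rfl⟩,
    h2⟩

theorem exists_pos_of_mem_openHull_triple {a x y z : V} (hxa : x ≠ a) (hya : y ≠ a) (hxy : x ≠ y)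
    (hz : z ∈ openHull {a, x, y}) :
    ∃ s t : ℝ, 0 < s ∧ 0 < t ∧ z - a = s • (x - a) + t • (y - a) := by
  classical
  obtain ⟨F, w, hF, hw, hw1, rfl⟩ := hz
  have : F = {a, x, y} := by
    apply Finset.coe_injective
    rw [hF]
    simp
  subst this
  refine ⟨w x, w y, hw x (by simp), hw y (by simp), ?_⟩
  rw [Finset.sum_insert (by simp [hxa.symm, hya.symm]), Finset.sum_insert (by simp [hxy]),
    Finset.sum_singleton] at hw1 ⊢
  have : w a = 1 - (w x + w y) := by linarith
  rw [this]
  module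

end OpenHull

/-! ### Angles in a half-plane -/

section Angles

variable {V : Type*} [NormedAddCommGroup V] [NormedSpace ℝ V]

/-- Positivity of `g` on both vectors excludes opposite directions, so dependent vectors lie on the
same ray. -/
theorem linearIndependent_of_notMem_openRay {a x y : V} {g : V →ₗ[ℝ] ℝ} (hx : 0 < g (x - a))
    (hy : 0 < g (y - a)) (h : y ∉ openRay a x) : LinearIndependent ℝ ![x - a, y - a] := by
  rw [LinearIndependent.pair_iff]
  intro s t hst
  have hg := congrArg g hst
  simp only [map_add, map_smul, smul_eq_mul, map_zero] at hg
  by_cases ht : t = 0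
  · subst ht
    rw [zero_mul, add_zero] at hg
    exact ⟨(mul_eq_zero.1 hg).resolve_right hx.ne', rfl⟩
  · refine absurd (mem_openRay_iff.2 ⟨-s / t, ?_, ?_⟩) h
    · have : g (y - a) = -s / t * g (x - a) := by
        field_simp
        linarith
      rw [this] at hy
      exact pos_of_mul_pos_left hy hx.le
    · have : t • (y - a) = (-s) • (x - a) := by
        rw [neg_smul]
        exact eq_neg_of_add_eq_zero_right hst
      rw [div_eq_inv_mul, mul_smul, ← this, smul_smul, inv_mul_cancel₀ ht, one_smul]

/-- The overlap forces `0 < δ`, hence `γ ≤ 0`. Cramer's rule, with a determinant that `g` shows to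
be positive, writes `u` and `v` with nonnegative coefficients in `u'`, `v'`. As neither lies in the
open angle of `u'`, `v'`, the coefficients `-β` and `-γ` vanish. -/
theorem eq_smul_of_angles_aux {u v u' v' : V} {g : V →ₗ[ℝ] ℝ} (hu : 0 < g u)
    (hu' : 0 < g u') (hv' : 0 < g v') {α β γ δ s t : ℝ}
    (h1 : u' = α • u + β • v) (h2 : v' = γ • u + δ • v) (ht : 0 < t) (hs : 0 < s)
    (hv0 : 0 < s * β + t * δ)
    (nv' : ¬(0 < γ ∧ 0 < δ)) (nu : ∀ s t : ℝ, 0 < s → 0 < t → u ≠ s • u' + t • v')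
    (nv : ∀ s t : ℝ, 0 < s → 0 < t → v ≠ s • u' + t • v') (hα : 0 < α) (hβ : β ≤ 0) :
    β = 0 ∧ γ = 0 ∧ 0 < δ := by
  have hδ : 0 < δ := by
    by_contra hδ
    nlinarith
  have hγ : γ ≤ 0 := not_lt.1 fun h => nv' ⟨h, hδ⟩
  have hΔu : (α * δ - β * γ) • u = δ • u' + (-β) • v' := by
    rw [h1, h2]; module
  have hΔv : (α * δ - β * γ) • v = (-γ) • u' + α • v' := by
    rw [h1, h2]; module
  have hΔ : 0 < α * δ - β * γ := by
    have := congrArg g hΔu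
    simp only [map_add, map_smul, smul_eq_mul] at this
    refine pos_of_mul_pos_left (b := g u) ?_ hu.le
    rw [this]
    have : 0 ≤ -β * g v' := mul_nonneg (by linarith) hv'.le
    have : 0 < δ * g u' := mul_pos hδ hu'
    linarith
  have hdiv : ∀ (x : V) (c d : ℝ), (α * δ - β * γ) • x = c • u' + d • v' →
      x = (c / (α * δ - β * γ)) • u' + (d / (α * δ - β * γ)) • v' := fun x c d h => by
    rw [div_eq_inv_mul, div_eq_inv_mul, mul_smul, mul_smul, ← smul_add, ← h, smul_smul,
      inv_mul_cancel₀ hΔ.ne', one_smul]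
  refine ⟨?_, ?_, hδ⟩
  · by_contra h
    exact nu _ _ (div_pos hδ hΔ) (div_pos (neg_pos.2 (lt_of_le_of_ne hβ h)) hΔ) (hdiv _ _ _ hΔu)
  · by_contra h
    exact nv _ _ (div_pos (neg_pos.2 (lt_of_le_of_ne hγ h)) hΔ) (div_pos hα hΔ) (hdiv _ _ _ hΔv)

/-- Two angles in a half-plane, none of which contains a ray of the other one in its interior, are
equal if their interiors meet. -/
theorem eq_smul_of_angles {u v u' v' : V} {g : V →ₗ[ℝ] ℝ} (hu : 0 < g u) (hv : 0 < g v)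
    (hu' : 0 < g u') (hv' : 0 < g v') (hind : LinearIndependent ℝ ![u, v])
    (hus : u' ∈ Submodule.span ℝ {u, v}) (hvs : v' ∈ Submodule.span ℝ {u, v})
    (hmeet : ∃ s t s' t' : ℝ, 0 < s ∧ 0 < t ∧ 0 < s' ∧ 0 < t' ∧
      s • u + t • v = s' • u' + t' • v')
    (nu' : ∀ s t : ℝ, 0 < s → 0 < t → u' ≠ s • u + t • v)
    (nv' : ∀ s t : ℝ, 0 < s → 0 < t → v' ≠ s • u + t • v)
    (nu : ∀ s t : ℝ, 0 < s → 0 < t → u ≠ s • u' + t • v')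
    (nv : ∀ s t : ℝ, 0 < s → 0 < t → v ≠ s • u' + t • v') :
    (∃ r r' : ℝ, 0 < r ∧ 0 < r' ∧ u' = r • u ∧ v' = r' • v) ∨
      (∃ r r' : ℝ, 0 < r ∧ 0 < r' ∧ u' = r • v ∧ v' = r' • u) := by
  obtain ⟨α, β, h1⟩ := Submodule.mem_span_pair.1 hus
  obtain ⟨γ, δ, h2⟩ := Submodule.mem_span_pair.1 hvs
  obtain ⟨s, t, s', t', hs, ht, hs', ht', hst⟩ := hmeet
  have hcoef : (s - (s' * α + t' * γ)) • u + (t - (s' * β + t' * δ)) • v = 0 := by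
    rw [← h1, ← h2, ← sub_eq_zero] at hst
    rw [← hst]
    module
  obtain ⟨h3, h4⟩ := LinearIndependent.pair_iff.1 hind _ _ hcoef
  have nu'' : ¬(0 < α ∧ 0 < β) := fun h => nu' α β h.1 h.2 h1.symm
  have nv'' : ¬(0 < γ ∧ 0 < δ) := fun h => nv' γ δ h.1 h.2 h2.symm
  -- If `α ≤ 0`, then `0 < g u'` forces `0 < β`, and this case is the first one with `u` and `v`
  -- exchanged.
  rcases lt_or_ge 0 α with hα | hα
  · have hβ : β ≤ 0 := not_lt.1 fun h => nu'' ⟨hα, h⟩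
    obtain ⟨rfl, rfl, hδ⟩ := eq_smul_of_angles_aux hu hu' hv' h1.symm h2.symm ht' hs'
      (by linarith) nv'' nu nv hα hβ
    exact Or.inl ⟨α, δ, hα, hδ, by rw [← h1]; simp, by rw [← h2]; simp⟩
  · have hβ : 0 < β := by
      by_contra hβ
      have : g u' ≤ 0 := by
        rw [← h1]
        simp only [map_add, map_smul, smul_eq_mul]
        nlinarith
      linarith
    obtain ⟨rfl, rfl, hγ⟩ := eq_smul_of_angles_aux (u := v) (v := u) hv hu' hv'
      (by rw [← h1, add_comm]) (by rw [← h2, add_comm]) ht' hs' (by linarith)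
      (fun h => nv'' h.symm) nv nu hβ hα
    exact Or.inr ⟨β, γ, hβ, hγ, by rw [← h1]; simp, by rw [← h2]; simp⟩

end Angles

/-! ### Basic properties of the constructed pieces -/

section Simplices

variable {V : Type*} [NormedAddCommGroup V] [NormedSpace ℝ V] {n N : ℕ}

theorem mem_simplices_iff {E s : Set V} :
    s ∈ simplices n E ↔
      ∃ p : Fin (n + 1) → V, range p = s ∧ (∀ i, p i ∈ E) ∧ AffineIndependent ℝ p := by
  constructor
  · rintro ⟨hsE, hcard, hind⟩
    have hfin : s.Finite := finite_of_ncard_ne_zero (by omega)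
    have : Fintype s := hfin.fintype
    have hc : Fintype.card s = n + 1 := by rw [← hcard, ← Nat.card_eq_fintype_card]; rfl
    let f := Fintype.equivFinOfCardEq hc
    refine ⟨fun i => f.symm i, ?_, fun i => hsE (f.symm i).2, hind.comp_embedding f.symm.toEmbedding⟩
    change range (((↑) : s → V) ∘ f.symm) = s
    rw [f.symm.surjective.range_comp ((↑) : s → V), Subtype.range_coe]
  · rintro ⟨p, rfl, hp, hind⟩
    refine ⟨range_subset_iff.2 hp, ?_, hind.range⟩
    rw [← image_univ, ncard_image_of_injective _ hind.injective, ncard_univ,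
      Nat.card_eq_fintype_card, Fintype.card_fin]

theorem IsConstruction.simplex_mem {e : Fin N → V} {T : Set (Piece V)}
    (h : IsConstruction n e T) : ∀ t ∈ T, t.simplex ∈ simplices n (range e) := by
  induction h with
  | plane e he c hc =>
    rintro _ ⟨k, s, ⟨i, j, hi, hj, hray, -, -, -, rfl⟩, rfl⟩
    obtain ⟨g, hg⟩ := he.exists_pos k
    refine mem_simplices_iff.2 ⟨![e k, e i, e j], ?_, ?_, affineIndependent_triple_iff.2 <|
      linearIndependent_of_notMem_openRay (hg _ ⟨i, hi, rfl⟩) (hg _ ⟨j, hj, rfl⟩) hray⟩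
    · ext z
      simp only [Matrix.range_cons, Matrix.range_empty, union_empty, mem_union,
        mem_singleton_iff, mem_insert_iff]
    · intro i
      fin_cases i
      exacts [mem_range_self _, mem_range_self _, mem_range_self _]
  | @step n N e he f hf M e' he' T hT' c hc ih =>
    rintro _ ⟨k, t, ht, rfl⟩
    obtain ⟨p, hp, hpE, hind⟩ := mem_simplices_iff.1 (ih k t ht)
    have hpS : ∀ i, p i ∈ sectionPoints e k (f k) := fun i => he' k ▸ hpE i
    refine mem_simplices_iff.2 ⟨Fin.cons (e k) fun i => nearest (range e) (e k) (p i), ?_, ?_, ?_⟩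
    · rw [Fin.range_cons, Piece.lift, ← hp, ← range_comp]
      rfl
    · exact Fin.cases (mem_range_self k) fun i => (he.nearest_sectionPoints (hpS i)).1.1
    · exact affineIndependent_cons_of_mem_openRay
        (fun i => (he.nearest_sectionPoints (hpS i)).1.2.1)
        (affineIndependent_cons_of_hyperplane ((hf k).1 k le_rfl).ne (fun i => (hpS i).1) hind)

theorem IsConstruction.apexes_subset {e : Fin N → V} {T : Set (Piece V)}
    (h : IsConstruction n e T) : ∀ t ∈ T, ∀ x ∈ t.apexes, x ∈ t.simplex := by
  induction h with
  | plane e he c hc =>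
    rintro _ ⟨k, s, ⟨i, j, -, -, -, -, -, -, rfl⟩, rfl⟩ x hx
    rw [List.mem_singleton.1 hx]
    exact mem_insert _ _
  | @step n N e he f hf M e' he' T hT' c hc ih =>
    rintro _ ⟨k, t, ht, rfl⟩ x hx
    rcases List.mem_cons.1 hx with rfl | hx
    · exact mem_insert _ _
    · obtain ⟨y, hy, rfl⟩ := List.mem_map.1 hx
      exact mem_insert_of_mem _ (mem_image_of_mem _ (ih k t ht y hy))

theorem IsConstruction.admissible {e : Fin N → V} {T : Set (Piece V)}
    (h : IsConstruction n e T) : ∀ t ∈ T, t.Admissible n (range e) := by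
  cases h with
  | plane _ he c hc =>
    rintro _ ⟨k, s, hs, rfl⟩
    exact hc k s hs
  | step _ he f hf M e' he' T hT' c hc =>
    rintro _ ⟨k, t, ht, rfl⟩
    exact hc k t ht

end Simplices

/-! ### Overlaps and the triangular order -/

section Overlaps

variable {V : Type*} [NormedAddCommGroup V] [NormedSpace ℝ V] {n N : ℕ}

/-- The simplex of `s` overlaps with the simplex of `t`, and meets all the open simplices spanned
by initial parts of the list of apexes of `t`. -/
structure Piece.Overlaps (s t : Piece V) : Prop where
  inter : (openHull s.simplex ∩ openHull t.simplex).Nonempty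
  apexes : ∀ l : List V, l ≠ [] → l <+: t.apexes →
    (convexHull ℝ s.simplex ∩ openHull {x | x ∈ l}).Nonempty

theorem Piece.Overlaps.mem_convexHull {s t : Piece V} (h : s.Overlaps t) {a : V} {l : List V}
    (hl : t.apexes = a :: l) : a ∈ convexHull ℝ s.simplex := by
  obtain ⟨x, hx, hxa⟩ := h.apexes [a] (by simp) (by simp [hl])
  simp only [List.mem_singleton, ofPred_eq_eq_singleton] at hxa
  rwa [← mem_singleton_iff.1 (openHull_singleton a hxa)]

/-- Pieces chosen at different points. -/
theorem IsSeparatedOrder.not_overlaps {e : Fin N → V} (he : IsSeparatedOrder e) {k k' : Fin N}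
    (hk : k < k') {s t : Piece V} (hs : s.simplex ⊆ insert (e k') (laterPoints e k')) {l : List V}
    (ht : t.apexes = e k :: l) : ¬s.Overlaps t := fun h =>
  he.notMem_convexHull (le_refl k) <| convexHull_mono
    (hs.trans (insert_subset (mem_image_of_mem e hk) (image_mono fun _ hi => hk.trans hi)))
    (h.mem_convexHull ht)

/-- Projection from `e k` to a separating hyperplane. -/
theorem IsSeparatedOrder.overlaps_of_lift {e : Fin N → V} (he : IsSeparatedOrder e) {k : Fin N}
    {f : V →ᵃ[ℝ] ℝ} (hf : Separates e k f) {s t : Piece V} {c d : Set V}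
    (hs : s.simplex ⊆ sectionPoints e k f) (ht : t.simplex ⊆ sectionPoints e k f)
    (hsf : s.simplex.Finite) (htf : t.simplex.Finite)
    (hsn : s.simplex.Nonempty) (htn : t.simplex.Nonempty) (hta : ∀ x ∈ t.apexes, x ∈ t.simplex)
    (h : (s.lift (range e) (e k) c).Overlaps (t.lift (range e) (e k) d)) : s.Overlaps t := by
  have hfk := hf.1 k le_rfl
  have hray : ∀ x ∈ sectionPoints e k f, nearest (range e) (e k) x ∈ openRay (e k) x :=
    fun x hx => (he.nearest_sectionPoints hx).1.2.1
  -- Distinct section points lie on distinct rays, hence have distinct lifts.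
  have hinj : InjOn (nearest (range e) (e k)) (sectionPoints e k f) := fun x hx y hy hxy =>
    eq_of_mem_openRay hfk hy.1 hx.1 (openRay_trans (hray y hy) (hxy ▸ openRay_symm (hray x hx)))
  have hne : ∀ x ∈ sectionPoints e k f, nearest (range e) (e k) x ≠ e k :=
    fun x hx => he.ne (he.nearest_sectionPoints hx).2
  have hf0 : ∀ A ⊆ sectionPoints e k f, ∀ x ∈ convexHull ℝ A, f x = 0 := fun A hA x hx =>
    convexHull_min (fun y hy => (hA hy).1 : A ⊆ f ⁻¹' {0})
      ((convex_singleton (0 : ℝ)).affine_preimage f) hx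
  have hopen : ∀ A ⊆ sectionPoints e k f, A.Finite → A.Nonempty →
      ∀ y ∈ openHull (insert (e k) (nearest (range e) (e k) '' A)),
      ∃ y' ∈ openHull A, y ∈ openRay (e k) y' := fun A hA hAf hAn y hy =>
    exists_openHull_of_cone hAf hAn (fun x hx => hray x (hA hx)) (hinj.mono hA)
      (fun x hx => hne x (hA hx)) hy
  have hnek : ∀ {y y' : V}, f y' = 0 → y ∈ openRay (e k) y' → y ≠ e k := by
    rintro _ y' hy' hyy' rfl
    obtain ⟨r, hr, h⟩ := mem_openRay_iff.1 hyy'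
    rw [sub_self] at h
    have := sub_eq_zero.1 ((smul_eq_zero.1 h.symm).resolve_left hr.ne')
    rw [this] at hy'
    exact hfk.ne hy'
  constructor
  · obtain ⟨y, hys, hyt⟩ := h.inter
    obtain ⟨y₁, hy₁, hr₁⟩ := hopen _ hs hsf hsn y hys
    obtain ⟨y₂, hy₂, hr₂⟩ := hopen _ ht htf htn y hyt
    have : y₁ = y₂ := eq_of_mem_openRay hfk (hf0 _ ht _ (openHull_subset_convexHull _ hy₂))
      (hf0 _ hs _ (openHull_subset_convexHull _ hy₁)) (openRay_trans hr₂ (openRay_symm hr₁))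
    exact ⟨y₁, hy₁, this ▸ hy₂⟩
  · intro l hl hpre
    have hlS : {x | x ∈ l} ⊆ sectionPoints e k f := fun x hx => ht (hta x (hpre.subset hx))
    have hset : {x | x ∈ e k :: l.map (nearest (range e) (e k))} =
        insert (e k) (nearest (range e) (e k) '' {x | x ∈ l}) := by
      ext x
      simp
    -- An initial part `l` below corresponds to the initial part above that is longer by `e k`. As
    -- `l` is nonempty, the common point is not `e k` and can be projected.
    obtain ⟨y, hys, hyl⟩ := h.apexes (e k :: l.map (nearest (range e) (e k)))
      (List.cons_ne_nil _ _) (List.cons_prefix_cons.2 ⟨rfl, hpre.map _⟩)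
    rw [hset] at hyl
    obtain ⟨y₂, hy₂, hr₂⟩ := hopen _ hlS l.finite_toSet (List.exists_mem_of_ne_nil l hl) y hyl
    have hf₂ := hf0 _ hlS _ (openHull_subset_convexHull _ hy₂)
    obtain ⟨y₁, hy₁, hr₁⟩ := exists_convexHull_of_cone hsf (fun x hx => hray x (hs hx))
      (hinj.mono hs) (fun x hx => hne x (hs hx)) hys (hnek hf₂ hr₂)
    have : y₁ = y₂ := eq_of_mem_openRay hfk hf₂ (hf0 _ hs _ hy₁)
      (openRay_trans hr₂ (openRay_symm hr₁))
    exact ⟨y₁, hy₁, this ▸ hy₂⟩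

/-- Triangles with the same apex in a plane. -/
theorem IsSeparatedOrder.eq_of_planeSimplices {e : Fin N → V} (he : IsSeparatedOrder e)
    (hdim : Module.finrank ℝ (vectorSpan ℝ (range e)) ≤ 2) {k : Fin N} {s t : Set V}
    (hs : s ∈ planeSimplices e k) (ht : t ∈ planeSimplices e k)
    (h : (openHull s ∩ openHull t).Nonempty) : s = t := by
  obtain ⟨i, j, hi, hj, hray, hang, hni, hnj, rfl⟩ := hs
  obtain ⟨i', j', hi', hj', hray', hang', hni', hnj', rfl⟩ := ht
  obtain ⟨g, hg⟩ := he.exists_pos k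
  have hg' : ∀ i, k < i → 0 < g (e i - e k) := fun i hi => hg _ ⟨i, hi, rfl⟩
  have hne : ∀ i, k < i → e i ≠ e k := fun i hi => he.ne ⟨i, hi, rfl⟩
  have hne' : ∀ {i j}, e j ∉ openRay (e k) (e i) → e i ≠ e j := fun h h' =>
    h (h' ▸ self_mem_openRay _ _)
  have hind := linearIndependent_of_notMem_openRay (hg' i hi) (hg' j hj) hray
  have hfd : FiniteDimensional ℝ (vectorSpan ℝ (range e)) :=
    finiteDimensional_vectorSpan_of_finite ℝ (finite_range e)
  have hmem : ∀ i, e i - e k ∈ vectorSpan ℝ (range e) := fun i =>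
    vsub_mem_vectorSpan ℝ (mem_range_self i) (mem_range_self k)
  -- By the dimension bound, the directions of the first triangle span those of all points, so the
  -- two angles can be compared in one plane.
  have hspan : Submodule.span ℝ {e i - e k, e j - e k} = vectorSpan ℝ (range e) := by
    refine Submodule.eq_of_le_of_finrank_le ?_ ?_
    · rw [Submodule.span_le]
      rintro _ (rfl | rfl)
      exacts [hmem i, hmem j]
    · have := finrank_span_eq_card hind
      rw [Matrix.range_cons, Matrix.range_cons, Matrix.range_empty, union_empty,
        singleton_union, Fintype.card_fin] at this
      rw [this]
      exact hdim
  obtain ⟨z, hz, hz'⟩ := h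
  obtain ⟨s, t, hs, ht, hst⟩ := exists_pos_of_mem_openHull_triple (hne i hi) (hne j hj)
    (hne' hray) hz
  obtain ⟨s', t', hs', ht', hst'⟩ := exists_pos_of_mem_openHull_triple (hne i' hi') (hne j' hj')
    (hne' hray') hz'
  have hnot : ∀ {x y : V}, (∀ l, k < l → e l ∉ openAngle (e k) x y) → ∀ l, k < l →
      ∀ s t : ℝ, 0 < s → 0 < t → e l - e k ≠ s • (x - e k) + t • (y - e k) :=
    fun h l hl s t hs ht heq => h l hl (mem_openAngle_iff.2 ⟨s, t, hs, ht, heq⟩)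
  rcases eq_smul_of_angles (hg' i hi) (hg' j hj) (hg' i' hi') (hg' j' hj') hind
    (hspan ▸ hmem i') (hspan ▸ hmem j') ⟨s, t, s', t', hs, ht, hs', ht', hst.symm.trans hst'⟩
    (hnot hang i' hi') (hnot hang j' hj') (hnot hang' i hi) (hnot hang' j hj) with
    ⟨r, r', hr, hr', h1, h2⟩ | ⟨r, r', hr, hr', h1, h2⟩
  · rw [hni.unique hni' (mem_openRay_iff.2 ⟨r, hr, h1⟩),
      hnj.unique hnj' (mem_openRay_iff.2 ⟨r', hr', h2⟩)]
  · rw [hnj.unique hni' (mem_openRay_iff.2 ⟨r, hr, h1⟩),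
      hni.unique hnj' (mem_openRay_iff.2 ⟨r', hr', h2⟩), pair_comm]

/-- The directions of the section lie in those of `E` and in the kernel of the linear part of `f`,
which does not contain `e i - e k`; so the dimension drops. -/
theorem Separates.finrank_vectorSpan_sectionPoints {e : Fin N → V} {k : Fin N} {f : V →ᵃ[ℝ] ℝ}
    (hf : Separates e k f) (hdim : Module.finrank ℝ (vectorSpan ℝ (range e)) ≤ n + 1) :
    Module.finrank ℝ (vectorSpan ℝ (sectionPoints e k f)) ≤ n := by
  rcases (sectionPoints e k f).eq_empty_or_nonempty with h | ⟨x, hx⟩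
  · rw [h, vectorSpan_empty]
    simp
  have hfd : FiniteDimensional ℝ (vectorSpan ℝ (range e)) :=
    finiteDimensional_vectorSpan_of_finite ℝ (finite_range e)
  obtain ⟨-, i, hi, -⟩ := hx
  have hle : vectorSpan ℝ (sectionPoints e k f) ≤ vectorSpan ℝ (range e) := by
    rw [← direction_affineSpan, ← direction_affineSpan]
    refine AffineSubspace.direction_le (affineSpan_le.2 ?_)
    rintro x ⟨-, i, -, hx⟩
    rw [openSegment_eq_image_lineMap] at hx
    obtain ⟨r, -, rfl⟩ := hx
    exact AffineMap.lineMap_mem r (subset_affineSpan ℝ _ (mem_range_self k))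
      (subset_affineSpan ℝ _ (mem_range_self i))
  have hker : vectorSpan ℝ (sectionPoints e k f) ≤ LinearMap.ker f.linear := by
    rw [vectorSpan_def, Submodule.span_le]
    rintro _ ⟨x, hx, y, hy, rfl⟩
    have := f.linearMap_vsub x y
    rw [hx.1, hy.1, vsub_self] at this
    exact this
  have hlt : vectorSpan ℝ (sectionPoints e k f) < vectorSpan ℝ (range e) := by
    refine lt_of_le_of_ne hle fun heq => ?_
    have h0 : e i -ᵥ e k ∈ vectorSpan ℝ (range e) :=
      vsub_mem_vectorSpan ℝ (mem_range_self i) (mem_range_self k)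
    rw [← heq] at h0
    have h1 := hker h0
    rw [LinearMap.mem_ker, AffineMap.linearMap_vsub, vsub_eq_sub] at h1
    linarith [hf.1 k le_rfl, hf.2 i hi]
  have := Submodule.finrank_lt_finrank_of_lt hlt
  omega

theorem exists_pairwise_list {X : Type*} {R : X → X → Prop} {T : Fin N → Set X}
    (h : ∀ k, ∃ L : List X, (∀ t, t ∈ L ↔ t ∈ T k) ∧ L.Pairwise R)
    (hR : ∀ k k', k < k' → ∀ s ∈ T k, ∀ t ∈ T k', R s t) :
    ∃ L : List X, (∀ t, t ∈ L ↔ ∃ k, t ∈ T k) ∧ L.Pairwise R := by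
  choose L hL hp using h
  refine ⟨(List.finRange N).flatMap L, fun t => by simp [hL], ?_⟩
  rw [List.pairwise_flatMap]
  refine ⟨fun k _ => hp k, (List.pairwise_lt_finRange N).imp fun {k k'} hk s hs t ht => ?_⟩
  exact hR k k' hk s ((hL k s).1 hs) t ((hL k' t).1 ht)

/-- The constructed pieces can be listed in such a way that no piece overlaps with an earlier
one. -/
theorem IsConstruction.exists_pairwise_not_overlaps {e : Fin N → V} {T : Set (Piece V)}
    (h : IsConstruction n e T) (hdim : Module.finrank ℝ (vectorSpan ℝ (range e)) ≤ n) :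
    ∃ L : List (Piece V), (∀ t, t ∈ L ↔ t ∈ T) ∧ L.Pairwise fun t s => ¬s.Overlaps t := by
  induction h with
  | plane e he c hc =>
    refine exists_pairwise_list (X := Piece V)
      (T := fun k => {t : Piece V | ∃ s ∈ planeSimplices e k, t = ⟨[e k], s, c k s⟩}) (fun k => ?_) fun k k' hk => ?_
    · have hfin : (planeSimplices e k).Finite := (finite_range e).finite_subsets.subset (by
        rintro _ ⟨i, j, -, -, -, -, -, -, rfl⟩
        rintro _ (rfl | rfl | rfl) <;> exact mem_range_self _)
      refine ⟨hfin.toFinset.toList.map fun s => ⟨[e k], s, c k s⟩, fun t => ?_, ?_⟩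
      · simp [eq_comm]
      · rw [List.pairwise_map]
        refine hfin.toFinset.nodup_toList.imp_of_mem fun {s t} hs ht hst hov => hst ?_
        simp only [Finset.mem_toList, Finite.mem_toFinset] at hs ht
        exact he.eq_of_planeSimplices hdim hs ht (inter_comm _ _ ▸ hov.inter)
    · rintro _ ⟨s, hs, rfl⟩ _ ⟨t, ⟨i, j, hi, hj, -, -, -, -, rfl⟩, rfl⟩
      refine he.not_overlaps hk ?_ rfl
      rintro _ (rfl | rfl | rfl)
      exacts [mem_insert _ _, mem_insert_of_mem _ ⟨i, hi, rfl⟩, mem_insert_of_mem _ ⟨j, hj, rfl⟩]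
  | @step n N e he f hf M e' he' T hT' c hc ih =>
    have hsub : ∀ k, ∀ t ∈ T k, t.simplex ⊆ sectionPoints e k (f k) := fun k t ht =>
      he' k ▸ ((hT' k).simplex_mem t ht).1
    have hcard : ∀ k, ∀ t ∈ T k, t.simplex.ncard ≠ 0 := fun k t ht => by
      rw [((hT' k).simplex_mem t ht).2.1]
      omega
    refine exists_pairwise_list (X := Piece V)
      (T := fun k => {t | ∃ t' ∈ T k, t = t'.lift (range e) (e k) (c k t')})
      (fun k => ?_) fun k k' hk => ?_
    · obtain ⟨L, hL, hp⟩ := ih k (by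
        rw [he' k]
        exact (hf k).finrank_vectorSpan_sectionPoints hdim)
      refine ⟨L.map fun t => t.lift (range e) (e k) (c k t), fun t => ?_, ?_⟩
      · simp [hL, eq_comm]
      · rw [List.pairwise_map]
        refine hp.imp_of_mem fun {t s} ht hs hst hov => hst ?_
        rw [hL] at ht hs
        exact he.overlaps_of_lift (hf k) (hsub k s hs) (hsub k t ht)
          (finite_of_ncard_ne_zero (hcard k s hs)) (finite_of_ncard_ne_zero (hcard k t ht))
          (nonempty_of_ncard_ne_zero (hcard k s hs)) (nonempty_of_ncard_ne_zero (hcard k t ht))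
          ((hT' k).apexes_subset t ht) hov
    · rintro _ ⟨t, ht, rfl⟩ _ ⟨s, hs, rfl⟩
      refine he.not_overlaps hk (insert_subset_insert ?_) rfl
      rintro _ ⟨x, hx, rfl⟩
      exact (he.nearest_sectionPoints (hsub k' s hs hx)).2

end Overlaps

/-! ### Signed covering by facets -/

section SignedCount

/-- The weights of the convex combinations of the points `p i` that are equal to `x`. -/
def convexWeights {ι V : Type*} [Fintype ι] [AddCommGroup V] [Module ℝ V] (p : ι → V) (x : V) :
    Set (ι → ℝ) :=
  {μ | (∀ i, 0 ≤ μ i) ∧ ∑ i, μ i = 1 ∧ ∑ i, μ i • p i = x}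

theorem AffineIndependent.eq_of_weights {V ι : Type*} [AddCommGroup V] [Module ℝ V] [Fintype ι]
    {q : ι → V} (hq : AffineIndependent ℝ q) {w w' : ι → ℝ} (h : ∑ i, w i = ∑ i, w' i)
    (h' : ∑ i, w i • q i = ∑ i, w' i • q i) (i : ι) : w i = w' i := by
  refine sub_eq_zero.1 (affineIndependent_iff.1 hq Finset.univ (fun i => w i - w' i) ?_ ?_ i
    (Finset.mem_univ i))
  · rw [Finset.sum_sub_distrib, h, sub_self]
  · simp only [sub_smul, Finset.sum_sub_distrib, h', sub_self]

variable {V : Type*} [NormedAddCommGroup V] [NormedSpace ℝ V] {m : ℕ}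

theorem mem_convexHull_range_iff {ι : Type*} [Fintype ι] {q : ι → V} (hq : Function.Injective q)
    {x : V} : x ∈ convexHull ℝ (range q) ↔ (convexWeights q x).Nonempty := by
  classical
  have hF : range q = ↑(Finset.univ.image q) := by simp
  constructor
  · intro hx
    rw [hF] at hx
    obtain ⟨w, hw, h1, h2⟩ := Finset.mem_convexHull'.1 hx
    rw [Finset.sum_image hq.injOn] at h1 h2
    exact ⟨fun i => w (q i), fun i => hw _ (Finset.mem_image_of_mem q (Finset.mem_univ i)), h1, h2⟩
  · rintro ⟨w, hw, h1, h2⟩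
    exact mem_convexHull_of_exists_fintype w q hw h1 (fun i => mem_range_self i) h2

theorem pos_of_mem_openHull {ι : Type*} [Fintype ι] {q : ι → V} (hq : AffineIndependent ℝ q)
    {x : V} (hx : x ∈ openHull (range q)) {w : ι → ℝ} (hw : w ∈ convexWeights q x) (i : ι) :
    0 < w i := by
  classical
  obtain ⟨F, w', hF, hw', h1, h2⟩ := hx
  have : F = Finset.univ.image q := by
    apply Finset.coe_injective
    rw [hF]
    simp
  subst this
  rw [Finset.sum_image hq.injective.injOn] at h1 h2
  rw [hq.eq_of_weights (w' := fun i => w' (q i)) (hw.2.1.trans h1.symm) (hw.2.2.trans h2.symm) i]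
  exact hw' _ (Finset.mem_image_of_mem q (Finset.mem_univ i))

variable {p : Fin (m + 1) → V} {x : V}

theorem mem_convexWeights_face {i : Fin (m + 1)} {μ : Fin (m + 1) → ℝ} (hi : μ i = 0)
    (hμ : μ ∈ convexWeights p x) :
    (fun j => μ (i.succAbove j)) ∈ convexWeights (fun j => p (i.succAbove j)) x := by
  refine ⟨fun j => hμ.1 _, ?_, ?_⟩
  · have := hμ.2.1
    rwa [Fin.sum_univ_succAbove _ i, hi, zero_add] at this
  · have := hμ.2.2
    rwa [Fin.sum_univ_succAbove _ i, hi, zero_smul, zero_add] at this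

theorem mem_convexHull_face_iff {i : Fin (m + 1)}
    (hq : AffineIndependent ℝ fun j => p (i.succAbove j)) :
    x ∈ convexHull ℝ (range fun j => p (i.succAbove j)) ↔ ∃ μ ∈ convexWeights p x, μ i = 0 := by
  rw [mem_convexHull_range_iff hq.injective]
  constructor
  · rintro ⟨w, hw, h1, h2⟩
    refine ⟨Fin.insertNth i 0 w, ⟨fun j => ?_, ?_, ?_⟩, by simp⟩
    · rcases Fin.eq_self_or_eq_succAbove i j with rfl | ⟨l, rfl⟩
      · simp
      · simpa using hw l
    · simpa [Fin.sum_univ_succAbove _ i] using h1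
    · simpa [Fin.sum_univ_succAbove _ i] using h2
  · rintro ⟨μ, hμ, hi⟩
    exact ⟨_, mem_convexWeights_face hi hμ⟩

/-- A point in general position in the convex hull of `m + 1` points with the affine relation `l`
lies in exactly one of the simplices opposite to the points with positive coefficients. -/
theorem existsUnique_face {l : Fin (m + 1) → ℝ} (hl0 : ∑ i, l i = 0) (hlp : ∑ i, l i • p i = 0)
    (hind : ∀ i, l i ≠ 0 → AffineIndependent ℝ fun j => p (i.succAbove j))
    (hgen : ∀ i, l i ≠ 0 → ∀ μ ∈ convexWeights p x, μ i = 0 → ∀ j, j ≠ i → 0 < μ j)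
    (hx : (convexWeights p x).Nonempty) (hpos : ∃ i, 0 < l i) :
    ∃! i, 0 < l i ∧ ∃ μ ∈ convexWeights p x, μ i = 0 := by
  obtain ⟨μ, hμ⟩ := hx
  obtain ⟨i₀, hi₀⟩ := hpos
  -- The ratio test of the simplex method: subtract from `μ` the largest multiple of `l` that keeps
  -- all weights nonnegative. The weight that vanishes first gives the facet.
  obtain ⟨i, hi, hmin⟩ := Finset.exists_min_image (Finset.univ.filter fun i => 0 < l i)
    (fun i => μ i / l i) ⟨i₀, by simpa using hi₀⟩
  simp only [Finset.mem_filter, Finset.mem_univ, true_and] at hi hmin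
  obtain ⟨ν, hν, h0⟩ : ∃ ν ∈ convexWeights p x, ν i = 0 := by
    refine ⟨fun j => μ j - μ i / l i * l j, ⟨fun j => ?_, ?_, ?_⟩, ?_⟩
    · have h0 : 0 ≤ μ i / l i := div_nonneg (hμ.1 i) hi.le
      rcases lt_or_ge 0 (l j) with hj | hj
      · have := (le_div_iff₀ hj).1 (hmin j hj)
        linarith
      · have := mul_nonpos_of_nonneg_of_nonpos h0 hj
        have := hμ.1 j
        linarith
    · rw [Finset.sum_sub_distrib, ← Finset.mul_sum, hl0, hμ.2.1]
      simp
    · simp only [sub_smul, mul_smul, Finset.sum_sub_distrib, ← Finset.smul_sum, hlp, hμ.2.2]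
      simp
    · simp only
      field_simp
      ring
  refine ⟨i, ⟨hi, ν, hν, h0⟩, ?_⟩
  rintro i' ⟨hi', μ', hμ', h0'⟩
  by_contra hne
  have h1 := hgen i hi.ne' ν hν h0 i' hne
  have h2 := hgen i' hi'.ne' μ' hμ' h0' i (Ne.symm hne)
  obtain ⟨j, rfl⟩ := Fin.exists_succAbove_eq hne
  -- Cancelling the weight at `i` in `μ'` by a multiple of `l` must give `ν`, since the facet
  -- opposite `i` is independent. At the index of `i'` this makes `ν` negative, a contradiction.
  have h3 := (hind i hi.ne').eq_of_weights
    (w := fun j => ν (i.succAbove j))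
    (w' := fun j => μ' (i.succAbove j) - μ' i / l i * l (i.succAbove j)) ?_ ?_ j
  · simp only [h0', zero_sub] at h3
    have : 0 < μ' i / l i * l (i.succAbove j) := by positivity
    linarith
  · have e1 := hν.2.1
    have e2 := hμ'.2.1
    rw [Fin.sum_univ_succAbove _ i] at e1 e2 hl0
    rw [Finset.sum_sub_distrib, ← Finset.mul_sum, eq_neg_of_add_eq_zero_right hl0,
      eq_sub_of_add_eq' e1, eq_sub_of_add_eq' e2, h0]
    field_simp
    ring
  · have e1 := hν.2.2
    have e2 := hμ'.2.2
    rw [Fin.sum_univ_succAbove _ i] at e1 e2 hlp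
    simp only [sub_smul, mul_smul, Finset.sum_sub_distrib, ← Finset.smul_sum]
    rw [eq_neg_of_add_eq_zero_right hlp, eq_sub_of_add_eq' e1, eq_sub_of_add_eq' e2, h0,
      smul_neg, smul_smul, div_mul_cancel₀ _ hi.ne']
    module

theorem sum_ite_of_existsUnique {ι K : Type*} [Fintype ι] [AddCommMonoidWithOne K] {Q : ι → Prop}
    [DecidablePred Q]
    (h : ∃! i, Q i) : ∑ i, (if Q i then (1 : K) else 0) = 1 := by
  obtain ⟨i, hi, huniq⟩ := h
  rw [Fintype.sum_eq_single i fun j hj => if_neg fun h => hj (huniq j h), if_pos hi]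

-- If `x` lies in the hull and `l ≠ 0`, exactly one facet with positive and, applying
-- `existsUnique_face` to `-l`, exactly one with negative coefficient contains `x`. Otherwise both
-- counts are zero.
open Classical in
theorem sum_sign_mul_eq_zero {K : Type*} [Field K] {l : Fin (m + 1) → ℝ} (hl0 : ∑ i, l i = 0)
    (hlp : ∑ i, l i • p i = 0)
    (hind : ∀ i, l i ≠ 0 → AffineIndependent ℝ fun j => p (i.succAbove j))
    (hgen : ∀ i, l i ≠ 0 → ∀ μ ∈ convexWeights p x, μ i = 0 → ∀ j, j ≠ i → 0 < μ j) :
    ∑ i, ((SignType.sign (l i) : SignType) : K) *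
      (if x ∈ convexHull ℝ (range fun j => p (i.succAbove j)) then 1 else 0) = 0 := by
  have hterm : ∀ i, ((SignType.sign (l i) : SignType) : K) *
      (if x ∈ convexHull ℝ (range fun j => p (i.succAbove j)) then 1 else 0) =
      (if 0 < l i ∧ ∃ μ ∈ convexWeights p x, μ i = 0 then 1 else 0) -
        (if 0 < -l i ∧ ∃ μ ∈ convexWeights p x, μ i = 0 then 1 else 0) := by
    intro i
    rcases lt_trichotomy (l i) 0 with h | h | h
    · simp only [mem_convexHull_face_iff (hind i h.ne), sign_neg h, h.not_gt, neg_pos, h,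
        true_and, false_and, if_false, zero_sub, SignType.coe_neg_one, neg_one_mul]
    · simp [h]
    · simp only [mem_convexHull_face_iff (hind i h.ne'), sign_pos h, h.not_gt, neg_pos, h,
        true_and, false_and, if_false, sub_zero, SignType.coe_one, one_mul]
  rw [Finset.sum_congr rfl fun i _ => hterm i, Finset.sum_sub_distrib]
  by_cases hx : (convexWeights p x).Nonempty
  swap
  · have : ∀ i, ¬∃ μ ∈ convexWeights p x, μ i = 0 := fun i ⟨μ, hμ, _⟩ => hx ⟨μ, hμ⟩
    simp [this]
  by_cases hall : ∀ i, l i = 0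
  · simp [hall]
  push Not at hall
  obtain ⟨i, -, hi⟩ := Finset.exists_pos_of_sum_zero_of_exists_nonzero l hl0
    (by simpa using hall)
  have hl0' : ∑ i, -l i = 0 := by rw [Finset.sum_neg_distrib, hl0, neg_zero]
  obtain ⟨i', -, hi'⟩ := Finset.exists_pos_of_sum_zero_of_exists_nonzero (fun i => -l i) hl0'
    (by simpa using hall)
  rw [sum_ite_of_existsUnique (existsUnique_face hl0 hlp hind hgen hx ⟨i, hi⟩),
    sum_ite_of_existsUnique (existsUnique_face (l := fun i => -l i) hl0'
      (by simp only [neg_smul, Finset.sum_neg_distrib, hlp, neg_zero])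
      (fun i hi => hind i (neg_ne_zero.1 hi)) (fun i hi => hgen i (neg_ne_zero.1 hi)) hx
      ⟨i', hi'⟩), sub_self]

end SignedCount

/-! ### Orientation and affine relations -/

section Orientation

variable {V : Type*} [NormedAddCommGroup V] [NormedSpace ℝ V] {n : ℕ}

/-- The affine relation between `n + 2` points of an `n`-dimensional space. -/
noncomputable def AffineBasis.relation (b : AffineBasis (Fin (n + 1)) ℝ V) (p : Fin (n + 2) → V)
    (i : Fin (n + 2)) : ℝ :=
  (-1) ^ (i : ℕ) * (b.toMatrix fun j => p (i.succAbove j)).det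

theorem AffineBasis.det_ne_zero_iff (b : AffineBasis (Fin (n + 1)) ℝ V) {p : Fin (n + 1) → V} :
    (b.toMatrix p).det ≠ 0 ↔ AffineIndependent ℝ p := by
  rw [← isUnit_iff_ne_zero, ← Matrix.isUnit_iff_isUnit_det, b.isUnit_toMatrix_iff,
    and_iff_left_iff_imp]
  have := b.finiteDimensional
  exact fun h => h.affineSpan_eq_top_iff_card_eq_finrank_add_one.2 b.card_eq_finrank_add_one

/-- The sum is the expansion of a determinant along its first column, which repeats a later one. -/
theorem AffineBasis.sum_relation_mul_coord (b : AffineBasis (Fin (n + 1)) ℝ V)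
    (p : Fin (n + 2) → V) (j : Fin (n + 1)) : ∑ i, b.relation p i * b.coord j (p i) = 0 := by
  let M : Matrix (Fin (n + 2)) (Fin (n + 2)) ℝ := fun i =>
    Fin.cons (b.coord j (p i)) fun l => b.coord l (p i)
  have h0 : M.det = 0 := Matrix.det_zero_of_column_eq (Fin.succ_ne_zero j).symm fun i => by simp [M]
  rw [Matrix.det_succ_column_zero] at h0
  rw [← h0]
  refine Finset.sum_congr rfl fun i _ => ?_
  rw [relation, mul_right_comm]
  rfl

theorem AffineBasis.sum_relation (b : AffineBasis (Fin (n + 1)) ℝ V) (p : Fin (n + 2) → V) :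
    ∑ i, b.relation p i = 0 := by
  have h : ∀ i, b.relation p i = ∑ j, b.relation p i * b.coord j (p i) := fun i => by
    rw [← Finset.mul_sum, b.sum_coord_apply_eq_one, mul_one]
  rw [Finset.sum_congr rfl fun i _ => h i, Finset.sum_comm]
  exact Finset.sum_eq_zero fun j _ => b.sum_relation_mul_coord p j

theorem AffineBasis.sum_relation_smul (b : AffineBasis (Fin (n + 1)) ℝ V) (p : Fin (n + 2) → V) :
    ∑ i, b.relation p i • p i = 0 := by
  have h : ∀ i, b.relation p i • p i = ∑ j, (b.relation p i * b.coord j (p i)) • b j := fun i => by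
    simp only [mul_smul, ← Finset.smul_sum, b.linear_combination_coord_eq_self]
  rw [Finset.sum_congr rfl fun i _ => h i, Finset.sum_comm]
  exact Finset.sum_eq_zero fun j _ => by
    rw [← Finset.sum_smul, b.sum_relation_mul_coord, zero_smul]

theorem mem_openHull_of_notMem_walls {E s : Set V} (hs : s ∈ simplices n E) {x : V}
    (hx : x ∉ walls n E) (hxs : x ∈ convexHull ℝ s) : x ∈ openHull s := by
  have hfin : s.Finite := finite_of_ncard_ne_zero (by rw [hs.2.1]; omega)
  refine intrinsicInterior_convexHull_subset_openHull hfin ?_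
  rw [← intrinsicClosure_sdiff_intrinsicFrontier]
  exact ⟨subset_intrinsicClosure hxs, fun h => hx (mem_biUnion hs h)⟩

open Classical in
/-- The signed sum of the indicator functions of the facets of an `(n + 1)`-dimensional simplex that
is mapped to an `n`-dimensional space. -/
theorem AffineBasis.sum_sign_mul_eq_zero {K : Type*} [Field K]
    (b : AffineBasis (Fin (n + 1)) ℝ V) {E : Set V} {p : Fin (n + 2) → V} (hp : ∀ i, p i ∈ E)
    {x : V} (hx : x ∉ walls n E) :
    ∑ i, ((SignType.sign (b.relation p i) : SignType) : K) *
      (if x ∈ convexHull ℝ (range fun j => p (i.succAbove j)) then 1 else 0) = 0 := by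
  have hind : ∀ i, b.relation p i ≠ 0 → AffineIndependent ℝ fun j => p (i.succAbove j) :=
    fun i hi => b.det_ne_zero_iff.1 (right_ne_zero_of_mul hi)
  refine _root_.sum_sign_mul_eq_zero (b.sum_relation p) (b.sum_relation_smul p) hind
    fun i hi μ hμ h0 j hj => ?_
  have hface := mem_convexWeights_face h0 hμ
  obtain ⟨j, rfl⟩ := Fin.exists_succAbove_eq hj
  refine pos_of_mem_openHull (hind i hi) (mem_openHull_of_notMem_walls (E := E) ?_ hx ?_) hface j
  · exact mem_simplices_iff.2 ⟨_, rfl, fun j => hp _, hind i hi⟩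
  · exact (mem_convexHull_range_iff (hind i hi).injective).2 ⟨_, hface⟩

end Orientation

/-! ### Chambers and the span of the rows -/

section Chambers

variable {V : Type*} [NormedAddCommGroup V] [NormedSpace ℝ V] {n : ℕ}

theorem isOpen_intrinsicInterior {s : Set V} (hs : affineSpan ℝ s = ⊤) :
    IsOpen (intrinsicInterior ℝ s) := by
  have : IsOpen (affineSpan ℝ s : Set V) := by simp [hs]
  exact this.isOpenMap_subtype_val _ isOpen_interior

theorem affineSpan_of_mem_simplices [FiniteDimensional ℝ V] (hn : Module.finrank ℝ V = n)
    {E s : Set V} (hs : s ∈ simplices n E) : affineSpan ℝ (convexHull ℝ s) = ⊤ := by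
  obtain ⟨p, rfl, -, hp⟩ := mem_simplices_iff.1 hs
  rw [affineSpan_convexHull]
  exact hp.affineSpan_eq_top_iff_card_eq_finrank_add_one.2 (by simp [hn])

/-- Off the walls, a point of the simplex is in its open interior. A connected component therefore
cannot meet both the simplex and its complement. -/
theorem closure_component_subset_iff [FiniteDimensional ℝ V] (hn : Module.finrank ℝ V = n)
    {E s : Set V} (hs : s ∈ simplices n E) {x : V} (hx : x ∈ convexHull ℝ E \ walls n E) :
    closure (connectedComponentIn (convexHull ℝ E \ walls n E) x) ⊆ convexHull ℝ s ↔
      x ∈ convexHull ℝ s := by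
  have hxC := mem_connectedComponentIn hx
  have hclosed : IsClosed (convexHull ℝ s) :=
    (finite_of_ncard_ne_zero (s := s) (by rw [hs.2.1]; omega)).isClosed_convexHull ℝ
  refine ⟨fun h => h (subset_closure hxC), fun hxs => closure_minimal (fun y hy => ?_) hclosed⟩
  by_contra hys
  have hint : ∀ z ∈ connectedComponentIn (convexHull ℝ E \ walls n E) x, z ∈ convexHull ℝ s →
      z ∈ intrinsicInterior ℝ (convexHull ℝ s) := fun z hz hzs => by
    rw [← intrinsicClosure_sdiff_intrinsicFrontier]
    exact ⟨subset_intrinsicClosure hzs, fun h =>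
      (connectedComponentIn_subset _ _ hz).2 (mem_biUnion hs h)⟩
  obtain ⟨z, -, hz, hz'⟩ := isPreconnected_connectedComponentIn
    (intrinsicInterior ℝ (convexHull ℝ s)) (convexHull ℝ s)ᶜ
    (isOpen_intrinsicInterior (affineSpan_of_mem_simplices hn hs)) hclosed.isOpen_compl
    (fun z hz => or_iff_not_imp_right.2 fun h => hint z hz (not_not.1 h))
    ⟨x, hxC, hint x hxC hxs⟩ ⟨y, hy, hys⟩
  exact hz' (intrinsicInterior_subset hz)

/-- A point in the chamber, in general position. -/
theorem exists_chamber_point [FiniteDimensional ℝ V] (hn : Module.finrank ℝ V = n)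
    {E c : Set V} (hc : c ∈ chambers n E) :
    ∃ x ∉ walls n E, ∀ s ∈ simplices n E, c ⊆ convexHull ℝ s ↔ x ∈ convexHull ℝ s := by
  obtain ⟨x, hx, rfl⟩ := hc
  exact ⟨x, hx.2, fun s hs => closure_component_subset_iff hn hs hx⟩

/-- A general point of the chamber lies in both open simplices, and the points of adjacency to the
apex faces lie in the chamber, hence in the simplex of `s`. -/
theorem Piece.Admissible.overlaps [FiniteDimensional ℝ V] (hn : Module.finrank ℝ V = n)
    {E : Set V} {s t : Piece V} (hs : s.simplex ∈ simplices n E) (ht : t.simplex ∈ simplices n E)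
    (hadm : t.Admissible n E) (h : t.chamber ⊆ convexHull ℝ s.simplex) : s.Overlaps t := by
  obtain ⟨hc, hsub, hadj⟩ := hadm
  obtain ⟨x, hx, hxs⟩ := exists_chamber_point hn hc
  refine ⟨⟨x, mem_openHull_of_notMem_walls hs hx ((hxs _ hs).1 h),
    mem_openHull_of_notMem_walls ht hx ((hxs _ ht).1 hsub)⟩, fun l hl hpre => ?_⟩
  obtain ⟨y, hy, hyl⟩ := hadj l hl hpre
  exact ⟨y, h hy, intrinsicInterior_convexHull_subset_openHull l.finite_toSet hyl⟩

/-- The rows of the constructed simplices generate the row space. -/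
theorem IsConstruction.row_mem_span {K : Type*} [Field K] [FiniteDimensional ℝ V]
    (hn : Module.finrank ℝ V = n) {N : ℕ} {e : Fin N → V} {T : Set (Piece V)}
    (hT : IsConstruction n e T) (r : simplices n (range e)) :
    (fun c => incidence K n (range e) r c) ∈ Submodule.span K
      ((fun s c => incidence K n (range e) s c) '' simplexSet n (range e) T) := by
  classical
  choose x hxw hx using fun c : chambers n (range e) => exists_chamber_point hn c.2
  obtain ⟨b⟩ := AffineBasis.exists_affineBasis_of_finiteDimensional (k := ℝ) (P := V)
    (ι := Fin (n + 1)) (by simp [hn])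
  -- Orientation sign times incidence row, with the chamber replaced by its general point so that
  -- the signed count of facets applies.
  let φ : (Fin (n + 1) → V) → chambers n (range e) → K := fun p c =>
    ((SignType.sign (b.toMatrix p).det : SignType) : K) *
      if x c ∈ convexHull ℝ (range p) then 1 else 0
  have hφ : ∀ (s : simplices n (range e)) (p : Fin (n + 1) → V), range p = s →
      φ p = ((SignType.sign (b.toMatrix p).det : SignType) : K) •
        fun c => incidence K n (range e) s c := by
    intro s p hp
    funext c
    simp only [φ, hp, incidence, Pi.smul_apply, smul_eq_mul, hx c s s.2]
  set S := Submodule.span K ((fun s c => incidence K n (range e) s c) '' simplexSet n (range e) T)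
  obtain ⟨p, hp, hpE, hind⟩ := mem_simplices_iff.1 r.2
  have hcocycle : IsCocycleMod n (range e) S.toAddSubgroup φ := by
    refine ⟨fun p _ hdeg => ?_, fun p hp => ?_⟩
    · have h0 : (b.toMatrix p).det = 0 := by
        by_contra h
        exact hdeg (b.det_ne_zero_iff.1 h)
      have : φ p = 0 := by
        funext c
        simp [φ, h0]
      rw [this]
      exact S.zero_mem
    · have : ∑ i : Fin (n + 2), (-1 : ℤ) ^ (i : ℕ) • φ (fun j => p (i.succAbove j)) = 0 := by
        funext c
        rw [Pi.zero_apply, ← b.sum_sign_mul_eq_zero (K := K) hp (hxw c), Finset.sum_apply]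
        refine Finset.sum_congr rfl fun i _ => ?_
        rw [AffineBasis.relation]
        rcases Nat.even_or_odd (i : ℕ) with h | h
        · simp [h.neg_one_pow, φ]
        · simp [h.neg_one_pow, φ, Left.sign_neg]
      rw [this]
      exact S.zero_mem
  have hmem : φ p ∈ S := hT.cocycle_mem hcocycle (fun t ht q hq => by
    let s : simplices n (range e) := ⟨t.simplex, hT.simplex_mem t ht⟩
    rw [hφ s q hq]
    exact S.smul_mem _ (Submodule.subset_span ⟨s, ⟨t, ht, rfl⟩, rfl⟩)) p hpE
  rw [hφ r p hp] at hmem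
  refine (S.smul_mem_iff ?_).1 hmem
  -- The simplex is nondegenerate, so its sign is `±1` and can be cancelled.
  rcases lt_or_gt_of_ne (b.det_ne_zero_iff.2 hind) with h | h
  · simp [sign_neg h]
  · simp [sign_pos h]

end Chambers

/-! ### The main theorem -/

theorem mainTheorem3 {K : Type*} [Field K] [CharZero K]
    {V : Type*} [NormedAddCommGroup V] [NormedSpace ℝ V]
    (n : ℕ) (hn : Module.finrank ℝ V = n) {N : ℕ} (e : Fin N → V)
    (T : Set (Piece V)) (hT : IsConstruction n e T) :
    -- everything constructed is a simplex, respectively a chamber, of the point set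
    (∀ t ∈ T, t.simplex ∈ simplices n (range e) ∧ t.chamber ∈ chambers n (range e)) ∧
    -- the chambers are a basis `c` of the column space, the simplices a basis `b` of the row space
    ∃ (c : Module.Basis (chamberSet n (range e) T) K (colSpace (incidence K n (range e))))
      (b : Module.Basis (simplexSet n (range e) T) K (rowSpace (incidence K n (range e)))),
      (∀ γ, c γ = colVec (incidence K n (range e)) γ) ∧
      (∀ σ, b σ = rowVec (incidence K n (range e)) σ) ∧
      -- the row space and the column space are dual to each other under the pairing that the
      -- matrix induces, and the two bases, suitably numbered, form a triangular pair
      ∃ p : rowSpace (incidence K n (range e)) →ₗ[K] colSpace (incidence K n (range e)) →ₗ[K] K,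
        (∀ σ γ, p (rowVec (incidence K n (range e)) σ) (colVec (incidence K n (range e)) γ) =
          incidence K n (range e) σ γ) ∧
        ∃ (m : ℕ) (σ : simplexSet n (range e) T ≃ Fin m) (γ : chamberSet n (range e) T ≃ Fin m),
          IsTriangularPair p (b.reindex σ) (c.reindex γ) := by
  have hn0 : 0 < n := by
    cases hT with
    | plane => exact two_pos
    | step => exact Nat.succ_pos _
  -- Positivity of `n` rules out the default value `0` of `finrank` in infinite dimension.
  have hfd : FiniteDimensional ℝ V := Module.finite_of_finrank_pos (hn ▸ hn0)
  refine ⟨fun t ht => ⟨hT.simplex_mem t ht, (hT.admissible t ht).1⟩, ?_⟩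
  obtain ⟨L, hL, hpair⟩ := hT.exists_pairwise_not_overlaps (hn ▸ Submodule.finrank_le _)
  have hLT : ∀ i : Fin L.length, L.get i ∈ T := fun i => (hL _).1 (L.get_mem i)
  let σ : Fin L.length → simplices n (range e) := fun i =>
    ⟨(L.get i).simplex, hT.simplex_mem _ (hLT i)⟩
  let γ : Fin L.length → chambers n (range e) := fun i =>
    ⟨(L.get i).chamber, (hT.admissible _ (hLT i)).1⟩
  have hσ : range σ = simplexSet n (range e) T := by
    ext s
    constructor
    · rintro ⟨i, rfl⟩
      exact ⟨L.get i, hLT i, rfl⟩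
    · rintro ⟨t, ht, hts⟩
      obtain ⟨i, rfl⟩ := List.mem_iff_get.1 ((hL t).2 ht)
      exact ⟨i, Subtype.ext hts⟩
  have hγ : range γ = chamberSet n (range e) T := by
    ext s
    constructor
    · rintro ⟨i, rfl⟩
      exact ⟨L.get i, hLT i, rfl⟩
    · rintro ⟨t, ht, hts⟩
      obtain ⟨i, rfl⟩ := List.mem_iff_get.1 ((hL t).2 ht)
      exact ⟨i, Subtype.ext hts⟩
  have hsel : IsTriangularSelection (incidence K n (range e)) σ γ := by
    refine ⟨fun i k hki => if_neg fun h => ?_, fun i => if_pos (hT.admissible _ (hLT i)).2.1,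
      fun r => ?_⟩
    · exact List.pairwise_iff_get.1 hpair k i hki ((hT.admissible _ (hLT k)).overlaps hn
        (hT.simplex_mem _ (hLT i)) (hT.simplex_mem _ (hLT k)) h)
    · have := hT.row_mem_span (K := K) hn r
      rwa [← hσ, ← range_comp] at this
  exact hsel.exists_isTriangularPair hσ hγ
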